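/- Let $M$ be a smooth manifold, $A\subset TM\setminus\mathbf 0$ an open subset which is conic ($\lambda v\in A$ for $v\in A$, $\lambda>0$) and projects onto $M$, and $L:A\to\mathbb R$ a pseudo-Finsler metric: $L$ is smooth, $L(\lambda v)=\lambda^2L(v)$ for $v\in A$, $\lambda>0$, and for each $v\in A$ the fundamental tensor $$g_v(u,w)=\tfrac12\,\tfrac{\partial^2}{\partial t\,\partial s}L(v+tu+sw)\big|_{t=s=0},\qquad u,w\in T_{\pi(v)}M,$$ is nondegenerate. An $A$-anisotropic connection is a map $(X,Y)\mapsto\nabla_XY$ assigning to smooth vector fields $X,Y$ on $M$ a smooth section $v\mapsto\nabla^v_XY\in T_{\pi(v)}M$ over $A$ of the pullback of $TM$, which is additive in $Y$, satisfies $\nabla^v_X(fY)=X(f)Y+f\,\nabla^v_XY$ and is $C^\infty(M)$-linear in $X$. In coordinates, $\nabla^v_{\partial_i}\partial_j=\Gamma^k_{ij}(v)\partial_k$, and $\nabla$ is torsion-free if $\Gamma^k_{ij}=\Gamma^k_{ji}$. The tensor $\nabla g$ is given, for $p\in M$ and vector fields $X,Y,Z,V$ with $V_p=v\in A$, by $$(\nabla_Xg)_v(Y,Z)=X_p\big(g_V(Y,Z)\big)-\tfrac{d}{dt}g_{v+t\nabla^v_XV}(Y,Z)\big|_{t=0}-g_v(\nabla^v_XY,Z)-g_v(Y,\nabla^v_XZ).$$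 The Levi-Civita--Chern anisotropic connection of $L$ is the unique torsion-free $A$-anisotropic connection with $\nabla g=0$. For a smooth curve $\gamma:[a,b]\to M$, a smooth vector field $X$ along $\gamma$ and $v\in A\cap T_{\gamma(t)}M$, put $D^v_\gamma X=\big(\dot X^i+\Gamma^i_{jk}(v)\dot\gamma^jX^k\big)\partial_i$ at $t$. If $v\in A\cap T_{\gamma(a)}M$ and there is a smooth $A$-valued field $V$ along $\gamma$ with $D^V_\gamma V=0$ and $V(a)=v$, then the parallel transport of $v$ is said to be defined along $\gamma$, one puts $P_{a,b}(v)=V(b)$, and for $u\in T_{\gamma(a)}M$ one puts $P^v_{a,b}(u)=U(b)$, where $D^V_\gamma U=0$ and $U(a)=u$. The parallel transport of $\nabla$ preserves the fundamental tensor if $$g_{P_{a,b}(v)}\big(P^v_{a,b}(u),P^v_{a,b}(w)\big)=g_v(u,w)$$ for all smooth curves $\gamma:[a,b]\to M$, all $v\in A\cap T_{\gamma(a)}M$ whose parallel transport is defined along $\gamma$, and all $u,w\in T_{\gamma(a)}M$. Then the Levi-Civita--Chern anisotropic connection of $L$ exists and is the only torsion-free $A$-anisotropic connection whose parallel transport preserves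 the fundamental tensor: it is torsion-free and its parallel transport preserves the fundamental tensor, and every torsion-free $A$-anisotropic connection whose parallel transport preserves the fundamental tensor coincides with it. -/

import Mathlib

open Set Filter Topology Bundle
open scoped Manifold ContDiff

noncomputable section

namespace Aniso

section Basic

variable {E : Type*} [NormedAddCommGroup E] [NormedSpace ℝ E]
variable {M : Type*} [TopologicalSpace M] [ChartedSpace E M]

/-- The total space of the tangent bundle of `M`. -/
abbrev TM (E : Type*) [NormedAddCommGroup E] [NormedSpace ℝ E]
    (M : Type*) [TopologicalSpace M] [ChartedSpace E M] : Type _ :=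
  TangentBundle 𝓘(ℝ, E) M

/-- The tangent space of `M` at `p`. -/
abbrev T (E : Type*) [NormedAddCommGroup E] [NormedSpace ℝ E]
    {M : Type*} [TopologicalSpace M] [ChartedSpace E M] (p : M) : Type _ :=
  TangentSpace 𝓘(ℝ, E) p

/-- The tangent vector `v ∈ T_p M`, as a point of the total space `TM`. -/
abbrev vec (p : M) (v : T E p) : TM E M := ⟨p, v⟩

/-- The coordinates of a tangent vector in the chart of `M` around `x₀`
(meaningful when its base point lies in the domain of that chart). -/
def coords (x₀ : M) [IsManifold 𝓘(ℝ, E) ∞ M] (v : TM E M) : E :=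
  (trivializationAt E (TangentSpace 𝓘(ℝ, E)) x₀ v).2

/-- The tangent vector at `p` with coordinates `e` in the chart of `M` around `x₀`. -/
def ofCoords (x₀ : M) [IsManifold 𝓘(ℝ, E) ∞ M] (p : M) (e : E) : T E p :=
  (trivializationAt E (TangentSpace 𝓘(ℝ, E)) x₀).symm p e

/-! ### Pseudo-Finsler metrics -/

/-- The fundamental tensor
`g_v(u, w) = (1/2) ∂²/∂t∂s L(v + t u + s w)` at `t = s = 0`. -/
def fundamentalTensor (L : TM E M → ℝ) (v : TM E M) (u w : T E v.proj) : ℝ :=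
  (1 / 2) * deriv (fun t : ℝ =>
    deriv (fun s : ℝ => L (vec v.proj (v.snd + t • u + s • w))) 0) 0

/-- The vertical derivative of the fundamental tensor at `v` in the direction `z`:
`(∂̇_z g)_v(u, w) = d/dt g_{v + t z}(u, w)` at `t = 0`. -/
def verticalDeriv (L : TM E M → ℝ) (v : TM E M) (z u w : T E v.proj) : ℝ :=
  deriv (fun t : ℝ => fundamentalTensor L (vec v.proj (v.snd + t • z)) u w) 0

/-- `L : A → ℝ` is a pseudo-Finsler metric with domain the open set `A ⊆ TM \ 0`, which is conic
and projects onto `M`. The function `L` is written as a function on `TM`; its values outside `A`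
play no role. -/
structure IsPseudoFinslerMetric [IsManifold 𝓘(ℝ, E) ∞ M]
    (A : TopologicalSpace.Opens (TM E M)) (L : TM E M → ℝ) : Prop where
  ne_zero : ∀ (p : M) (v : T E p), vec p v ∈ A → v ≠ 0
  conic : ∀ (p : M) (v : T E p) (c : ℝ), vec p v ∈ A → 0 < c → vec p (c • v) ∈ A
  surj : ∀ p : M, ∃ v : T E p, vec p v ∈ A
  smooth : ContMDiffOn 𝓘(ℝ, E).tangent 𝓘(ℝ, ℝ) ∞ L A
  homogeneous : ∀ (p : M) (v : T E p) (c : ℝ), vec p v ∈ A → 0 < c →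
    L (vec p (c • v)) = c ^ 2 * L (vec p v)
  nondegenerate : ∀ (p : M) (v : T E p), vec p v ∈ A → ∀ u : T E p,
    (∀ w : T E p, fundamentalTensor L (vec p v) u w = 0) → u = 0

/-! ### Vector fields -/

/-- The smooth vector fields on `M`. -/
abbrev VField (E : Type*) [NormedAddCommGroup E] [NormedSpace ℝ E]
    (M : Type*) [TopologicalSpace M] [ChartedSpace E M] [IsManifold 𝓘(ℝ, E) ∞ M] : Type _ :=
  ContMDiffSection 𝓘(ℝ, E) E ∞ (TangentSpace 𝓘(ℝ, E) : M → Type _)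

/-- The smooth real functions on `M`. -/
abbrev SFun (E : Type*) [NormedAddCommGroup E] [NormedSpace ℝ E]
    (M : Type*) [TopologicalSpace M] [ChartedSpace E M] : Type _ :=
  ContMDiffMap 𝓘(ℝ, E) 𝓘(ℝ, ℝ) M ℝ ∞

variable [IsManifold 𝓘(ℝ, E) ∞ M]

/-- The product `f X` of a smooth function and a smooth vector field. -/
def fmul (f : SFun E M) (X : VField E M) : VField E M where
  toFun := fun p => f p • X p
  contMDiff_toFun := f.contMDiff.smul_section X.contMDiff

/-- Near every point of the domain of a chart, a vector field with constant coordinates coincides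
with a global smooth vector field. -/
theorem exists_coordField [FiniteDimensional ℝ E] [T2Space M] (x₀ p : M)
    (hp : p ∈ (chartAt E x₀).source) (e : E) :
    ∃ X : VField E M, ∀ᶠ q in 𝓝 p, X q = ofCoords x₀ q e := by
  have hs : (chartAt E x₀).source ∈ 𝓝 p := (chartAt E x₀).open_source.mem_nhds hp
  obtain ⟨f, hf, -⟩ := (SmoothBumpFunction.nhds_basis_support (I := 𝓘(ℝ, E)) hs).mem_iff.1
    (Filter.univ_mem (f := 𝓝 p))
  have hsec : ContMDiffOn 𝓘(ℝ, E) 𝓘(ℝ, E).tangent ∞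
      (fun q => vec q (ofCoords x₀ q e)) (chartAt E x₀).source := by
    intro q hq
    have hq' : q ∈ (trivializationAt E (TangentSpace 𝓘(ℝ, E)) x₀).baseSet := by simpa using hq
    refine ((trivializationAt E (TangentSpace 𝓘(ℝ, E)) x₀).contMDiffWithinAt_section _ hq').2 ?_
    refine (contMDiffWithinAt_const (c := e)).congr (fun y hy => ?_) ?_
    · have hy' : y ∈ (trivializationAt E (TangentSpace 𝓘(ℝ, E)) x₀).baseSet := by simpa using hy
      simp [ofCoords, Trivialization.apply_mk_symm _ hy']
    · simp [ofCoords, Trivialization.apply_mk_symm _ hq']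
  refine ⟨⟨fun q => f q • ofCoords x₀ q e, ?_⟩, ?_⟩
  · exact ContMDiffOn.smul_section_of_tsupport f.contMDiff.contMDiffOn
      (chartAt E x₀).open_source hf hsec
  · filter_upwards [f.eventuallyEq_one] with q hq
    change f q • ofCoords x₀ q e = _
    rw [hq]
    simp

open Classical in
/-- A global smooth vector field which, near `p`, has the constant coordinates `e` in the chart
around `x₀`. -/
def coordField [FiniteDimensional ℝ E] [T2Space M] (x₀ p : M) (e : E) : VField E M :=
  if hp : p ∈ (chartAt E x₀).source then (exists_coordField x₀ p hp e).choose else 0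

end Basic

section Connection

variable {E : Type*} [NormedAddCommGroup E] [NormedSpace ℝ E]
variable {M : Type*} [TopologicalSpace M] [ChartedSpace E M] [IsManifold 𝓘(ℝ, E) ∞ M]

/-! ### Anisotropic connections -/

/-- An `A`-anisotropic connection: a map `(X, Y) ↦ ∇_X Y` from pairs of vector fields on `M` to
`A`-anisotropic vector fields, i.e. smooth sections over `A` of the pullback of `TM`, which is
additive and Leibniz in `Y`, and linear over the smooth functions on `M` in `X`. -/
structure Connection (A : TopologicalSpace.Opens (TM E M)) where
  /-- `toFun X Y v` is `∇^v_X Y`. -/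
  toFun : VField E M → VField E M → (v : A) → T E v.1.proj
  smooth : ∀ X Y : VField E M, ContMDiff 𝓘(ℝ, E).tangent 𝓘(ℝ, E).tangent ∞
    (fun v : A => vec v.1.proj (toFun X Y v))
  add_right : ∀ (X Y Z : VField E M) (v : A), toFun X (Y + Z) v = toFun X Y v + toFun X Z v
  leibniz : ∀ (f : SFun E M) (X Y : VField E M) (v : A),
    toFun X (fmul f Y) v =
      (mvfderiv 𝓘(ℝ, E) f v.1.proj (X v.1.proj)) • Y v.1.proj + f v.1.proj • toFun X Y v
  linear_left : ∀ (f h : SFun E M) (X Y Z : VField E M) (v : A),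
    toFun (fmul f X + fmul h Y) Z v = f v.1.proj • toFun X Z v + h v.1.proj • toFun Y Z v

namespace Connection

variable {A : TopologicalSpace.Opens (TM E M)}

/-- `(∇_X g)_v(Y, Z)` for the fundamental tensor `g` of `L`, where `v = V_p`:
`X_p(g_V(Y, Z)) - (∂̇ g)_v(Y, Z, ∇^v_X V) - g_v(∇^v_X Y, Z) - g_v(Y, ∇^v_X Z)`. -/
def covDerivTensor (D : Connection A) (L : TM E M → ℝ) (X Y Z V : VField E M) (p : M)
    (hV : vec p (V p) ∈ A) : ℝ :=
  mvfderiv 𝓘(ℝ, E) (fun q => fundamentalTensor L (vec q (V q)) (Y q) (Z q)) p (X p)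
    - verticalDeriv L (vec p (V p)) (D.toFun X V ⟨vec p (V p), hV⟩) (Y p) (Z p)
    - fundamentalTensor L (vec p (V p)) (D.toFun X Y ⟨vec p (V p), hV⟩) (Z p)
    - fundamentalTensor L (vec p (V p)) (Y p) (D.toFun X Z ⟨vec p (V p), hV⟩)

/-- `∇ g = 0` for the fundamental tensor `g` of `L`. -/
def IsMetric (D : Connection A) (L : TM E M → ℝ) : Prop :=
  ∀ (X Y Z V : VField E M) (p : M) (hV : vec p (V p) ∈ A),
    D.covDerivTensor L X Y Z V p hV = 0

variable [FiniteDimensional ℝ E] [T2Space M]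

/-- The Christoffel symbols of the connection at `v`, in the coordinates given by the chart around
`x₀`, contracted with `u` and `w`: the `a`-th coordinate is `Γ^a_{ij}(v) u^i w^j`. -/
def christoffel (D : Connection A) (x₀ : M) (v : A) (u w : E) : E :=
  coords x₀ (vec v.1.proj
    (D.toFun (coordField x₀ v.1.proj u) (coordField x₀ v.1.proj w) v))

/-- The torsion `Γ^a_{ij} - Γ^a_{ji}` vanishes, in all coordinates. -/
def IsTorsionFree (D : Connection A) : Prop :=
  ∀ (x₀ : M) (v : A), v.1.proj ∈ (chartAt E x₀).source →
    ∀ u w : E, D.christoffel x₀ v u w - D.christoffel x₀ v w u = 0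

/-- The Levi-Civita--Chern connection of `L`: torsion-free and such that `∇ g = 0`. -/
def IsLeviCivitaChern (D : Connection A) (L : TM E M → ℝ) : Prop :=
  D.IsTorsionFree ∧ D.IsMetric L

/-! ### Parallel transport -/

/-- The covariant derivative `D^v_γ X` at the instant `t` along a curve `γ : [a, b] → M`, with
reference vector `v ∈ A ∩ T_{γ(t)} M`. In coordinates it is
`(dX^i/dt + Γ^i_{jk}(v) (dγ^j/dt) X^k) ∂_i`. -/
def covDerivAlong (D : Connection A) (γ : ℝ → M) (a b : ℝ) (X : ∀ t, T E (γ t)) (t : ℝ)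
    (v : T E (γ t)) (hv : vec (γ t) v ∈ A) : T E (γ t) :=
  ofCoords (γ t) (γ t)
    (derivWithin (fun τ => coords (γ t) (vec (γ τ) (X τ))) (Icc a b) t
      + D.christoffel (γ t) ⟨vec (γ t) v, hv⟩
          (coords (γ t) (vec (γ t) (mfderivWithin 𝓘(ℝ, ℝ) 𝓘(ℝ, E) γ (Icc a b) t (1 : ℝ))))
          (coords (γ t) (vec (γ t) (X t))))

/-- `V` is a parallel observer along `γ : [a, b] → M`: a smooth vector field along `γ` with values
in `A` such that `D^V_γ V = 0`. Then `P_{a,b}(V(a)) = V(b)`. -/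
structure IsParallelObserver (D : Connection A) (γ : ℝ → M) (a b : ℝ)
    (V : ∀ t, T E (γ t)) : Prop where
  smooth : ContMDiffOn 𝓘(ℝ, ℝ) 𝓘(ℝ, E).tangent ∞ (fun t => vec (γ t) (V t)) (Icc a b)
  admissible : ∀ t ∈ Icc a b, vec (γ t) (V t) ∈ A
  parallel : ∀ t (ht : t ∈ Icc a b), D.covDerivAlong γ a b V t (V t) (admissible t ht) = 0

/-- `W` is parallel with respect to the parallel observer `V` along `γ : [a, b] → M`: a smooth
vector field along `γ` such that `D^V_γ W = 0`. Then `P^v_{a,b}(W(a)) = W(b)`, with `v = V(a)`. -/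
structure IsParallelField (D : Connection A) (γ : ℝ → M) (a b : ℝ)
    (V W : ∀ t, T E (γ t)) (hV : D.IsParallelObserver γ a b V) : Prop where
  smooth : ContMDiffOn 𝓘(ℝ, ℝ) 𝓘(ℝ, E).tangent ∞ (fun t => vec (γ t) (W t)) (Icc a b)
  parallel : ∀ t (ht : t ∈ Icc a b),
    D.covDerivAlong γ a b W t (V t) (hV.admissible t ht) = 0

/-- The parallel transport of the connection preserves the fundamental tensor of `L`:
`g_{P_{a,b}(v)}(P^v_{a,b}(u), P^v_{a,b}(w)) = g_v(u, w)` for every smooth curve `γ : [a, b] → M`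
and every `v ∈ A ∩ T_{γ(a)} M` whose parallel transport is defined along `γ`. -/
def PreservesFundamentalTensor (D : Connection A) (L : TM E M → ℝ) : Prop :=
  ∀ (a b : ℝ) (γ : ℝ → M), a < b → ContMDiffOn 𝓘(ℝ, ℝ) 𝓘(ℝ, E) ∞ γ (Icc a b) →
    ∀ (V U W : ∀ t, T E (γ t)) (hV : D.IsParallelObserver γ a b V),
      D.IsParallelField γ a b V U hV → D.IsParallelField γ a b V W hV →
        fundamentalTensor L (vec (γ b) (V b)) (U b) (W b) =
          fundamentalTensor L (vec (γ a) (V a)) (U a) (W a)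

end Connection

end Connection

end Aniso

end

/-!
In a chart, a torsion-free anisotropic connection with `∇g = 0` satisfies the Koszul formula for the
Christoffel symbols, in which the derivatives of `g` are taken along the horizontal directions
`(u, -Γ(u, v))` and thus involve the unknown `Γ(u, v)`. Because `L` is homogeneous, the vertical
derivative of `g_v` vanishes as soon as one of its arguments is `v`. Hence the formula determines
first the spray `Γ(v, v)`, then the nonlinear connection `Γ(·, v)` and finally `Γ`; read backwards,
this defines symbols that depend smoothly on `v`. The charts are glued by uniqueness, which holds at
each `v` separately.

Differentiating `g_V(U, W)` along a curve on which `V`, `U` and `W` are parallel gives `∇g`, so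
`∇g = 0` makes parallel transport preserve `g`. Conversely, transport along the coordinate lines
exists for a short time with any initial values, and its derivative at time `0` recovers `∇g`.
-/

set_option maxSynthPendingDepth 3

noncomputable section

namespace Aniso

section ChernSymbol

variable {E : Type*} [NormedAddCommGroup E] [NormedSpace ℝ E]

/-- The passage from the derivative `T` of a metric to its Christoffel symbols of the first kind
`(u, w, a) ↦ (T(u; w, a) + T(w; u, a) - T(a; u, w)) / 2`. -/
def christoffelForm (T : E →L[ℝ] E →L[ℝ] E →L[ℝ] ℝ) : E →L[ℝ] E →L[ℝ] E →L[ℝ] ℝ :=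
  let rotate : E →L[ℝ] E →L[ℝ] E →L[ℝ] ℝ :=
    ((ContinuousLinearMap.flipₗᵢ ℝ E E ℝ).toContinuousLinearEquiv : _ →L[ℝ] _) ∘L T.flip
  (1 / 2 : ℝ) • (T + T.flip - rotate)

theorem christoffelForm_apply (T : E →L[ℝ] E →L[ℝ] E →L[ℝ] ℝ) (u w a : E) :
    christoffelForm T u w a = 1 / 2 * (T u w a + T w u a - T a u w) := by
  simp [christoffelForm]

/-- The data from which the Christoffel symbols of a pseudo-Finsler metric at a vector `v` are
computed: the fundamental tensor `g` at `v`, its horizontal derivative `H` and its vertical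
derivative `C`. -/
structure IsChernData (g : E →L[ℝ] E →L[ℝ] ℝ) (H C : E →L[ℝ] E →L[ℝ] E →L[ℝ] ℝ) (v : E) :
    Prop where
  isInvertible : g.IsInvertible
  symm : ∀ u w, g u w = g w u
  horizontal_symm : ∀ a u w, H a u w = H a w u
  vertical_symm : ∀ a u w, C a u w = C a w u
  vertical_radial : ∀ a w, C a w v = 0

/-- In coordinates, the condition `∇g = 0` for the Christoffel symbols `Γ` at `v`, with `g`, `H`
and `C` as in `IsChernData`. -/
def IsCompatible (g : E →L[ℝ] E →L[ℝ] ℝ) (H C : E →L[ℝ] E →L[ℝ] E →L[ℝ] ℝ) (v : E)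
    (Γ : E →L[ℝ] E →L[ℝ] E) : Prop :=
  ∀ u w a, H u w a = C (Γ u v) w a + g (Γ u w) a + g w (Γ u a)

/-- The geodesic spray coefficients `Γ(v, v)`. -/
def spray (g : E →L[ℝ] E →L[ℝ] ℝ) (H : E →L[ℝ] E →L[ℝ] E →L[ℝ] ℝ) (v : E) : E :=
  g.inverse (christoffelForm H v v)

/-- The nonlinear connection `u ↦ Γ(u, v)`. -/
def nonlinearConnection (g : E →L[ℝ] E →L[ℝ] ℝ) (H C : E →L[ℝ] E →L[ℝ] E →L[ℝ] ℝ) (v : E) :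
    E →L[ℝ] E :=
  g.inverse ∘L ((christoffelForm H).flip v - (1 / 2 : ℝ) • C (spray g H v))

/-- The Christoffel symbols of the Levi-Civita--Chern connection: the horizontal derivative of `g`
is corrected by its vertical derivative along the nonlinear connection. -/
def chernSymbol (g : E →L[ℝ] E →L[ℝ] ℝ) (H C : E →L[ℝ] E →L[ℝ] E →L[ℝ] ℝ) (v : E) :
    E →L[ℝ] E →L[ℝ] E :=
  (ContinuousLinearMap.compL ℝ E (E →L[ℝ] ℝ) E g.inverse) ∘L
    christoffelForm (H - C ∘L nonlinearConnection g H C v)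

namespace IsChernData

variable {g : E →L[ℝ] E →L[ℝ] ℝ} {H C : E →L[ℝ] E →L[ℝ] E →L[ℝ] ℝ} {v : E}

theorem vertical_radial_left (h : IsChernData g H C v) (a w : E) : C a v w = 0 := by
  rw [h.vertical_symm, h.vertical_radial]

theorem eq_of_forall_apply_eq (h : IsChernData g H C v) {x y : E} (hxy : ∀ w, g x w = g y w) :
    x = y :=
  h.isInvertible.injective (ContinuousLinearMap.ext hxy)

theorem apply_chernSymbol (h : IsChernData g H C v) (u w a : E) :
    g (chernSymbol g H C v u w) a =
      christoffelForm (H - C ∘L nonlinearConnection g H C v) u w a :=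
  DFunLike.congr_fun (h.isInvertible.self_apply_inverse _) a

theorem apply_nonlinearConnection (h : IsChernData g H C v) (u a : E) :
    g (nonlinearConnection g H C v u) a =
      christoffelForm H u v a - 1 / 2 * C (spray g H v) u a :=
  DFunLike.congr_fun (h.isInvertible.self_apply_inverse _) a

theorem nonlinearConnection_self (h : IsChernData g H C v) :
    nonlinearConnection g H C v v = spray g H v := by
  refine h.eq_of_forall_apply_eq fun a => ?_
  rw [h.apply_nonlinearConnection, h.vertical_radial_left, mul_zero, sub_zero, spray,
    h.isInvertible.self_apply_inverse]

theorem chernSymbol_radial (h : IsChernData g H C v) (u : E) :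
    chernSymbol g H C v u v = nonlinearConnection g H C v u := by
  refine h.eq_of_forall_apply_eq fun a => ?_
  rw [h.apply_chernSymbol, h.apply_nonlinearConnection]
  simp only [christoffelForm_apply, sub_apply, ContinuousLinearMap.comp_apply,
    h.nonlinearConnection_self, h.vertical_radial, h.vertical_radial_left]
  ring

theorem chernSymbol_symm (h : IsChernData g H C v) (u w : E) :
    chernSymbol g H C v u w = chernSymbol g H C v w u := by
  refine h.eq_of_forall_apply_eq fun a => ?_
  simp only [h.apply_chernSymbol, christoffelForm_apply, sub_apply,
    ContinuousLinearMap.comp_apply, h.horizontal_symm a u w, h.vertical_symm _ u w]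
  ring

theorem isCompatible_chernSymbol (h : IsChernData g H C v) :
    IsCompatible g H C v (chernSymbol g H C v) := by
  intro u w a
  rw [h.symm w, h.chernSymbol_radial, h.apply_chernSymbol, h.apply_chernSymbol]
  simp only [christoffelForm_apply, sub_apply, ContinuousLinearMap.comp_apply,
    h.horizontal_symm u a w, h.vertical_symm _ a w]
  ring

section Uniqueness

-- In the application `ι` consists of the vector fields and `B` is the difference of two
-- connections, which is not assumed to depend on the values `val i` only.
variable {ι : Type*} {val : ι → E} {B : ι → ι → E} {r : ι}

theorem two_mul_apply_difference (h : IsChernData g H C v) (hsymm : ∀ i j, B i j = B j i)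
    (hB : ∀ i j k, C (B i r) (val j) (val k) + g (B i j) (val k) + g (val j) (B i k) = 0)
    (i j k : ι) :
    2 * g (B i j) (val k) = C (B k r) (val i) (val j) - C (B i r) (val j) (val k)
      - C (B j r) (val i) (val k) := by
  have hi := hB i j k
  have hj := hB j i k
  have hk := hB k i j
  rw [h.symm (val j)] at hi
  rw [h.symm (val i), hsymm j i] at hj
  rw [h.symm (val i), hsymm k i, hsymm k j] at hk
  linarith

/-- Setting both, then one of the arguments equal to `r` makes the vertical terms vanish. -/
theorem difference_eq_zero (h : IsChernData g H C v) (hval : Function.Surjective val)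
    (hr : val r = v) (hsymm : ∀ i j, B i j = B j i)
    (hB : ∀ i j k, C (B i r) (val j) (val k) + g (B i j) (val k) + g (val j) (B i k) = 0)
    (i j : ι) : B i j = 0 := by
  have eq_zero {i j : ι} (hij : ∀ k, C (B k r) (val i) (val j) - C (B i r) (val j) (val k)
      - C (B j r) (val i) (val k) = 0) : B i j = 0 := by
    refine h.eq_of_forall_apply_eq fun w => ?_
    obtain ⟨k, rfl⟩ := hval w
    have := h.two_mul_apply_difference hsymm hB i j k
    rw [map_zero, zero_apply]
    linarith [hij k]
  have radial_radial : B r r = 0 := eq_zero fun k => by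
    simp only [hr, h.vertical_radial_left, sub_zero]
  have radial (i : ι) : B i r = 0 := eq_zero fun k => by
    simp only [hr, h.vertical_radial, h.vertical_radial_left, radial_radial, map_zero,
      zero_apply, sub_zero]
  exact eq_zero fun k => by simp only [radial, map_zero, zero_apply, sub_zero]

end Uniqueness

end IsChernData

section Smoothness

variable {F : Type*} [NormedAddCommGroup F] [NormedSpace ℝ F] {s : Set F} {n : WithTop ℕ∞}

theorem contDiffOn_flip {T : F → E →L[ℝ] E →L[ℝ] E →L[ℝ] ℝ} (hT : ContDiffOn ℝ n T s) :
    ContDiffOn ℝ n (fun x => (T x).flip) s :=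
  (ContinuousLinearMap.flipₗᵢ ℝ E E (E →L[ℝ] ℝ)).contDiff.comp_contDiffOn hT

theorem contDiffOn_christoffelForm {T : F → E →L[ℝ] E →L[ℝ] E →L[ℝ] ℝ}
    (hT : ContDiffOn ℝ n T s) : ContDiffOn ℝ n (fun x => christoffelForm (T x)) s :=
  have hflip := contDiffOn_flip hT
  ((hT.add hflip).sub (contDiffOn_const.clm_comp hflip)).const_smul (1 / 2 : ℝ)

theorem contDiffOn_chernSymbol [CompleteSpace E] {g : F → E →L[ℝ] E →L[ℝ] ℝ}
    {H C : F → E →L[ℝ] E →L[ℝ] E →L[ℝ] ℝ} {v : F → E} (hg : ContDiffOn ℝ n g s)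
    (hg_inv : ∀ x ∈ s, (g x).IsInvertible) (hH : ContDiffOn ℝ n H s) (hC : ContDiffOn ℝ n C s)
    (hv : ContDiffOn ℝ n v s) :
    ContDiffOn ℝ n (fun x => chernSymbol (g x) (H x) (C x) (v x)) s := by
  have hinv : ContDiffOn ℝ n (fun x => (g x).inverse) s := fun x hx =>
    (hg_inv x hx).contDiffAt_map_inverse.comp_contDiffWithinAt x (hg x hx)
  have hspray : ContDiffOn ℝ n (fun x => spray (g x) (H x) (v x)) s :=
    hinv.clm_apply (((contDiffOn_christoffelForm hH).clm_apply hv).clm_apply hv)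
  have hN : ContDiffOn ℝ n (fun x => nonlinearConnection (g x) (H x) (C x) (v x)) s :=
    hinv.clm_comp (((contDiffOn_flip (contDiffOn_christoffelForm hH)).clm_apply hv).sub
      ((hC.clm_apply hspray).const_smul _))
  exact ((ContinuousLinearMap.compL ℝ E (E →L[ℝ] ℝ) E).contDiff.comp_contDiffOn hinv).clm_comp
    (contDiffOn_christoffelForm (hH.sub (hC.clm_comp hN)))

end Smoothness

end ChernSymbol

section LocalMetric

variable {E : Type*} [NormedAddCommGroup E] [NormedSpace ℝ E]

/-- Half of the Hessian of `ℓ : E × E → ℝ` with respect to the second variable: in coordinates,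
the fundamental tensor of `ℓ`. -/
def vertHess (ℓ : E × E → ℝ) (z : E × E) : E →L[ℝ] E →L[ℝ] ℝ :=
  (1 / 2 : ℝ) • ((ContinuousLinearMap.inr ℝ E E).precomp ℝ ∘L
    fderiv ℝ (fderiv ℝ ℓ) z ∘L ContinuousLinearMap.inr ℝ E E)

/-- The derivative of `vertHess ℓ` with respect to the first variable. -/
def horizDeriv (ℓ : E × E → ℝ) (z : E × E) : E →L[ℝ] E →L[ℝ] E →L[ℝ] ℝ :=
  fderiv ℝ (vertHess ℓ) z ∘L ContinuousLinearMap.inl ℝ E E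

/-- The derivative of `vertHess ℓ` with respect to the second variable: twice the Cartan tensor
of `ℓ`. -/
def vertDeriv (ℓ : E × E → ℝ) (z : E × E) : E →L[ℝ] E →L[ℝ] E →L[ℝ] ℝ :=
  fderiv ℝ (vertHess ℓ) z ∘L ContinuousLinearMap.inr ℝ E E

/-- The Christoffel symbols at `z` of the Levi-Civita--Chern connection of a pseudo-Finsler metric
with coordinate expression `ℓ`. -/
def localChernSymbol (ℓ : E × E → ℝ) (z : E × E) : E →L[ℝ] E →L[ℝ] E :=
  chernSymbol (vertHess ℓ z) (horizDeriv ℓ z) (vertDeriv ℓ z) z.2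

/-- The condition `∇g = 0` at `z` for the Christoffel symbols `Γ` and a pseudo-Finsler metric with
coordinate expression `ℓ`. -/
def IsCompatibleAt (ℓ : E × E → ℝ) (z : E × E) (Γ : E →L[ℝ] E →L[ℝ] E) : Prop :=
  IsCompatible (vertHess ℓ z) (horizDeriv ℓ z) (vertDeriv ℓ z) z.2 Γ

/-- The properties of the coordinate expression `ℓ` of a pseudo-Finsler metric on an open set `Ω`
of pairs (point, vector). -/
structure IsLocalMetric (Ω : Set (E × E)) (ℓ : E × E → ℝ) : Prop where
  isOpen : IsOpen Ω
  smooth : ContDiffOn ℝ ∞ ℓ Ω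
  homogeneous : ∀ z ∈ Ω, ∀ c : ℝ, 0 < c → ℓ (z.1, c • z.2) = c ^ 2 * ℓ z
  nondegenerate : ∀ z ∈ Ω, ∀ u : E, (∀ w : E, vertHess ℓ z u w = 0) → u = 0

section VerticalDerivatives

variable {ℓ : E × E → ℝ} {z : E × E}

theorem vertHess_apply (u w : E) :
    vertHess ℓ z u w = 1 / 2 * fderiv ℝ (fderiv ℝ ℓ) z (0, u) (0, w) := by
  simp [vertHess]

theorem fderiv_vertHess_eq_add (ξ η : E) :
    fderiv ℝ (vertHess ℓ) z (ξ, η) = horizDeriv ℓ z ξ + vertDeriv ℓ z η := by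
  simp [horizDeriv, vertDeriv, ← map_add]

theorem hasDerivAt_vertical_line {F : Type*} [NormedAddCommGroup F] [NormedSpace ℝ F]
    {f : E × E → F} (hf : DifferentiableAt ℝ f z) (a : E) :
    HasDerivAt (fun t : ℝ => f (z.1, z.2 + t • a)) (fderiv ℝ f z (0, a)) 0 := by
  have hline (t : ℝ) : z + t • ((0, a) : E × E) = (z.1, z.2 + t • a) := by ext <;> simp
  simpa only [HasLineDerivAt, hline] using hf.hasFDerivAt.hasLineDerivAt ((0, a) : E × E)

theorem deriv_deriv_eq_vertHess (hℓ : ContDiffAt ℝ 2 ℓ z) (u w : E) :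
    1 / 2 * deriv (fun t : ℝ => deriv (fun s : ℝ => ℓ (z.1, z.2 + t • u + s • w)) 0) 0 =
      vertHess ℓ z u w := by
  have hinner : (fun t : ℝ => deriv (fun s : ℝ => ℓ (z.1, z.2 + t • u + s • w)) 0) =ᶠ[𝓝 0]
      fun t => fderiv ℝ ℓ (z.1, z.2 + t • u) (0, w) := by
    have hcont : ContinuousAt (fun t : ℝ => ((z.1, z.2 + t • u) : E × E)) 0 := by fun_prop
    have hdiff : ∀ᶠ y in 𝓝 z, DifferentiableAt ℝ ℓ y :=
      (hℓ.eventually (by simp)).mono fun y hy => hy.differentiableAt (by simp)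
    filter_upwards [hcont.eventually (by simpa using hdiff)] with t ht
    exact (hasDerivAt_vertical_line ht w).deriv
  have houter := (hasDerivAt_vertical_line
    ((hℓ.fderiv_right (m := 1) le_rfl).differentiableAt (by simp)) u).clm_apply
    (hasDerivAt_const 0 ((0, w) : E × E))
  rw [hinner.deriv_eq, houter.deriv, vertHess_apply, map_zero, add_zero]

theorem vertHess_symm (hℓ : ContDiffAt ℝ 2 ℓ z) (u w : E) :
    vertHess ℓ z u w = vertHess ℓ z w u := by
  rw [vertHess_apply, vertHess_apply, hℓ.isSymmSndFDerivAt (by simp)]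

theorem fderiv_radial (hℓ : DifferentiableAt ℝ ℓ z)
    (hhom : ∀ᶠ c : ℝ in 𝓝 1, ℓ (z.1, c • z.2) = c ^ 2 * ℓ z) :
    fderiv ℝ ℓ z (0, z.2) = 2 * ℓ z := by
  have hray : HasDerivAt (fun c : ℝ => ((z.1, c • z.2) : E × E)) (0, z.2) 1 := by
    simpa using (hasDerivAt_const (1 : ℝ) z.1).prodMk ((hasDerivAt_id (1 : ℝ)).smul_const z.2)
  have hleft : HasDerivAt (fun c : ℝ => ℓ (z.1, c • z.2)) (fderiv ℝ ℓ z (0, z.2)) 1 :=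
    HasFDerivAt.comp_hasDerivAt 1 (by simpa using hℓ.hasFDerivAt) hray
  have hright : HasDerivAt (fun c : ℝ => c ^ 2 * ℓ z) (2 * ℓ z) 1 := by
    simpa using (hasDerivAt_pow 2 (1 : ℝ)).mul_const (ℓ z)
  exact hleft.unique (hright.congr_of_eventuallyEq hhom)

theorem vertHess_radial (hℓ : ContDiffAt ℝ 2 ℓ z)
    (heuler : ∀ᶠ y in 𝓝 z, fderiv ℝ ℓ y (0, y.2) = 2 * ℓ y) (w : E) :
    vertHess ℓ z w z.2 = 1 / 2 * fderiv ℝ ℓ z (0, w) := by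
  have hdiff : DifferentiableAt ℝ (fderiv ℝ ℓ) z :=
    (hℓ.fderiv_right (m := 1) le_rfl).differentiableAt (by simp)
  have hleft := hdiff.hasFDerivAt.clm_apply
    ((ContinuousLinearMap.inr ℝ E E).comp (ContinuousLinearMap.snd ℝ E E)).hasFDerivAt
  have hright := (hℓ.differentiableAt (by simp)).hasFDerivAt.const_mul 2
  have heq : fderiv ℝ ℓ z (0, w) + fderiv ℝ (fderiv ℝ ℓ) z (0, w) (0, z.2) =
      2 * fderiv ℝ ℓ z (0, w) := by
    simpa using DFunLike.congr_fun (hleft.unique (hright.congr_of_eventuallyEq heuler))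
      ((0, w) : E × E)
  rw [vertHess_apply]
  linarith

theorem vertDeriv_radial (hℓ : ContDiffAt ℝ 2 ℓ z) (hg : DifferentiableAt ℝ (vertHess ℓ) z)
    (heuler : ∀ᶠ y in 𝓝 z, ∀ w, vertHess ℓ y w y.2 = 1 / 2 * fderiv ℝ ℓ y (0, w)) (a w : E) :
    vertDeriv ℓ z a w z.2 = 0 := by
  have hdiff : DifferentiableAt ℝ (fderiv ℝ ℓ) z :=
    (hℓ.fderiv_right (m := 1) le_rfl).differentiableAt (by simp)
  have hleft := (hg.hasFDerivAt.clm_apply (hasFDerivAt_const w z)).clm_apply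
    (ContinuousLinearMap.snd ℝ E E).hasFDerivAt
  have hright := (hdiff.hasFDerivAt.clm_apply
    (hasFDerivAt_const ((0, w) : E × E) z)).const_mul (1 / 2 : ℝ)
  have heq : vertHess ℓ z w a + vertDeriv ℓ z a w z.2 =
      1 / 2 * fderiv ℝ (fderiv ℝ ℓ) z (0, a) (0, w) := by
    simpa [vertDeriv] using DFunLike.congr_fun (hleft.unique (hright.congr_of_eventuallyEq
      (heuler.mono fun y hy => hy w))) ((0, a) : E × E)
  rw [← vertHess_apply, vertHess_symm hℓ a w] at heq
  linarith

theorem exists_hasFDerivWithinAt_vertHess_apply {F : Type*} [NormedAddCommGroup F]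
    [NormedSpace ℝ F] {c v y w : F → E} {c' v' y' w' : F →L[ℝ] E} {s : Set F} {x : F}
    (hg : DifferentiableAt ℝ (vertHess ℓ) (c x, v x)) (hc : HasFDerivWithinAt c c' s x)
    (hv : HasFDerivWithinAt v v' s x) (hy : HasFDerivWithinAt y y' s x)
    (hw : HasFDerivWithinAt w w' s x) :
    ∃ d : F →L[ℝ] ℝ,
      HasFDerivWithinAt (fun q => vertHess ℓ (c q, v q) (y q) (w q)) d s x ∧
      ∀ ξ, d ξ = horizDeriv ℓ (c x, v x) (c' ξ) (y x) (w x)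
        + vertDeriv ℓ (c x, v x) (v' ξ) (y x) (w x)
        + vertHess ℓ (c x, v x) (y' ξ) (w x) + vertHess ℓ (c x, v x) (y x) (w' ξ) := by
  have hd := ((hg.hasFDerivAt.comp_hasFDerivWithinAt x (hc.prodMk hv)).clm_apply hy).clm_apply hw
  refine ⟨_, hd, fun ξ => ?_⟩
  simp only [add_apply, ContinuousLinearMap.comp_apply, ContinuousLinearMap.flip_apply,
    ContinuousLinearMap.prod_apply, fderiv_vertHess_eq_add, Function.comp_apply]
  ring

end VerticalDerivatives

namespace IsLocalMetric

variable {Ω : Set (E × E)} {ℓ : E × E → ℝ} {z : E × E}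

theorem contDiffAt (h : IsLocalMetric Ω ℓ) (hz : z ∈ Ω) : ContDiffAt ℝ ∞ ℓ z :=
  h.smooth.contDiffAt (h.isOpen.mem_nhds hz)

theorem contDiffAt_two (h : IsLocalMetric Ω ℓ) (hz : z ∈ Ω) : ContDiffAt ℝ 2 ℓ z :=
  (h.contDiffAt hz).of_le (WithTop.coe_le_coe.2 le_top)

theorem contDiffOn_vertHess (h : IsLocalMetric Ω ℓ) : ContDiffOn ℝ ∞ (vertHess ℓ) Ω :=
  have hderiv : ContDiffOn ℝ ∞ (fderiv ℝ (fderiv ℝ ℓ)) Ω :=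
    (h.smooth.fderiv_of_isOpen (m := ∞) h.isOpen (by simp)).fderiv_of_isOpen h.isOpen (by simp)
  (contDiffOn_const.clm_comp (hderiv.clm_comp contDiffOn_const)).const_smul (1 / 2 : ℝ)

theorem differentiableAt_vertHess (h : IsLocalMetric Ω ℓ) (hz : z ∈ Ω) :
    DifferentiableAt ℝ (vertHess ℓ) z :=
  (h.contDiffOn_vertHess.contDiffAt (h.isOpen.mem_nhds hz)).differentiableAt (by simp)

theorem contDiffOn_horizDeriv (h : IsLocalMetric Ω ℓ) : ContDiffOn ℝ ∞ (horizDeriv ℓ) Ω :=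
  (h.contDiffOn_vertHess.fderiv_of_isOpen h.isOpen (by simp)).clm_comp contDiffOn_const

theorem contDiffOn_vertDeriv (h : IsLocalMetric Ω ℓ) : ContDiffOn ℝ ∞ (vertDeriv ℓ) Ω :=
  (h.contDiffOn_vertHess.fderiv_of_isOpen h.isOpen (by simp)).clm_comp contDiffOn_const

theorem hasDerivAt_vertHess_vertical_line (h : IsLocalMetric Ω ℓ) (hz : z ∈ Ω) (a u w : E) :
    HasDerivAt (fun t : ℝ => vertHess ℓ (z.1, z.2 + t • a) u w) (vertDeriv ℓ z a u w) 0 := by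
  simpa [vertDeriv] using ((hasDerivAt_vertical_line (h.differentiableAt_vertHess hz) a).clm_apply
    (hasDerivAt_const 0 u)).clm_apply (hasDerivAt_const 0 w)

theorem fderiv_vertHess_symm (h : IsLocalMetric Ω ℓ) (hz : z ∈ Ω) (ξ : E × E) (u w : E) :
    fderiv ℝ (vertHess ℓ) z ξ u w = fderiv ℝ (vertHess ℓ) z ξ w u := by
  have happly (u w : E) := ((h.differentiableAt_vertHess hz).hasFDerivAt.clm_apply
    (hasFDerivAt_const u z)).clm_apply (hasFDerivAt_const w z)
  have hsymm : (fun y => vertHess ℓ y u w) =ᶠ[𝓝 z] fun y => vertHess ℓ y w u :=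
    (h.isOpen.eventually_mem hz).mono fun y hy => vertHess_symm (h.contDiffAt_two hy) u w
  simpa using DFunLike.congr_fun ((happly u w).unique ((happly w u).congr_of_eventuallyEq hsymm)) ξ

theorem fderiv_radial (h : IsLocalMetric Ω ℓ) (hz : z ∈ Ω) :
    fderiv ℝ ℓ z (0, z.2) = 2 * ℓ z :=
  Aniso.fderiv_radial ((h.contDiffAt hz).differentiableAt (by simp))
    ((lt_mem_nhds zero_lt_one).mono fun c hc => h.homogeneous z hz c hc)

theorem vertHess_radial (h : IsLocalMetric Ω ℓ) (hz : z ∈ Ω) (w : E) :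
    vertHess ℓ z w z.2 = 1 / 2 * fderiv ℝ ℓ z (0, w) :=
  Aniso.vertHess_radial (h.contDiffAt_two hz)
    ((h.isOpen.eventually_mem hz).mono fun _ hy => h.fderiv_radial hy) w

theorem isInvertible_vertHess [FiniteDimensional ℝ E] (h : IsLocalMetric Ω ℓ) (hz : z ∈ Ω) :
    (vertHess ℓ z).IsInvertible := by
  have hker : LinearMap.ker (vertHess ℓ z : E →ₗ[ℝ] E →L[ℝ] ℝ) = ⊥ :=
    LinearMap.ker_eq_bot'.2 fun u hu => h.nondegenerate z hz u fun w => DFunLike.congr_fun hu w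
  have hdim : Module.finrank ℝ E = Module.finrank ℝ (E →L[ℝ] ℝ) := by
    rw [← (LinearMap.toContinuousLinearMap (𝕜 := ℝ) (E := E) (F' := ℝ)).finrank_eq]
    exact Subspace.dual_finrank_eq.symm
  exact ⟨(LinearEquiv.ofInjectiveOfFinrankEq _ (LinearMap.ker_eq_bot.1 hker)
    hdim).toContinuousLinearEquiv, rfl⟩

theorem isChernData [FiniteDimensional ℝ E] (h : IsLocalMetric Ω ℓ) (hz : z ∈ Ω) :
    IsChernData (vertHess ℓ z) (horizDeriv ℓ z) (vertDeriv ℓ z) z.2 where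
  isInvertible := h.isInvertible_vertHess hz
  symm := vertHess_symm (h.contDiffAt_two hz)
  horizontal_symm a := h.fderiv_vertHess_symm hz (a, 0)
  vertical_symm a := h.fderiv_vertHess_symm hz (0, a)
  vertical_radial := vertDeriv_radial (h.contDiffAt_two hz) (h.differentiableAt_vertHess hz)
    ((h.isOpen.eventually_mem hz).mono fun _ hy => h.vertHess_radial hy)

theorem contDiffOn_localChernSymbol [FiniteDimensional ℝ E] (h : IsLocalMetric Ω ℓ) :
    ContDiffOn ℝ ∞ (localChernSymbol ℓ) Ω :=
  have := FiniteDimensional.complete ℝ E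
  contDiffOn_chernSymbol h.contDiffOn_vertHess (fun _ hz => h.isInvertible_vertHess hz)
    h.contDiffOn_horizDeriv h.contDiffOn_vertDeriv contDiffOn_snd

end IsLocalMetric

end LocalMetric

section Charts

variable {E : Type*} [NormedAddCommGroup E] [NormedSpace ℝ E]
variable {M : Type*} [TopologicalSpace M] [ChartedSpace E M] {x₀ p : M}

theorem symm_mem_chart_source {x : E} (hx : x ∈ (extChartAt 𝓘(ℝ, E) x₀).target) :
    (extChartAt 𝓘(ℝ, E) x₀).symm x ∈ (chartAt E x₀).source := by
  rw [← extChartAt_source 𝓘(ℝ, E)]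
  exact (extChartAt 𝓘(ℝ, E) x₀).map_target hx

theorem extChartAt_mem_target (hp : p ∈ (chartAt E x₀).source) :
    extChartAt 𝓘(ℝ, E) x₀ p ∈ (extChartAt 𝓘(ℝ, E) x₀).target :=
  (extChartAt 𝓘(ℝ, E) x₀).map_source (by rwa [extChartAt_source])

theorem symm_extChartAt (hp : p ∈ (chartAt E x₀).source) :
    (extChartAt 𝓘(ℝ, E) x₀).symm (extChartAt 𝓘(ℝ, E) x₀ p) = p :=
  (extChartAt 𝓘(ℝ, E) x₀).left_inv (by rwa [extChartAt_source])

theorem target_mem_nhds (hp : p ∈ (chartAt E x₀).source) :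
    (extChartAt 𝓘(ℝ, E) x₀).target ∈ 𝓝 (extChartAt 𝓘(ℝ, E) x₀ p) :=
  (isOpen_extChartAt_target x₀).mem_nhds (extChartAt_mem_target hp)

variable [IsManifold 𝓘(ℝ, E) ∞ M]

theorem mem_baseSet (hp : p ∈ (chartAt E x₀).source) :
    p ∈ (trivializationAt E (TangentSpace 𝓘(ℝ, E)) x₀).baseSet := by
  simpa using hp

theorem coords_eq_continuousLinearMapAt (hp : p ∈ (chartAt E x₀).source) (v : T E p) :
    coords x₀ (vec p v) =
      (trivializationAt E (TangentSpace 𝓘(ℝ, E)) x₀).continuousLinearMapAt ℝ p v := by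
  rw [Trivialization.continuousLinearMapAt_apply,
    Trivialization.coe_linearMapAt_of_mem _ (mem_baseSet hp)]
  rfl

theorem coords_eq_mfderiv (hp : p ∈ (chartAt E x₀).source) (v : T E p) :
    coords x₀ (vec p v) = mfderiv 𝓘(ℝ, E) 𝓘(ℝ, E) (extChartAt 𝓘(ℝ, E) x₀) p v := by
  rw [coords_eq_continuousLinearMapAt hp, TangentBundle.continuousLinearMapAt_trivializationAt hp]
  rfl

theorem coords_add (hp : p ∈ (chartAt E x₀).source) (v w : T E p) :
    coords x₀ (vec p (v + w)) = coords x₀ (vec p v) + coords x₀ (vec p w) := by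
  simp only [coords_eq_continuousLinearMapAt hp, map_add]

theorem coords_sub (hp : p ∈ (chartAt E x₀).source) (v w : T E p) :
    coords x₀ (vec p (v - w)) = coords x₀ (vec p v) - coords x₀ (vec p w) := by
  simp only [coords_eq_continuousLinearMapAt hp, map_sub]

theorem coords_smul (hp : p ∈ (chartAt E x₀).source) (c : ℝ) (v : T E p) :
    coords x₀ (vec p (c • v)) = c • coords x₀ (vec p v) := by
  simp only [coords_eq_continuousLinearMapAt hp, map_smul]

theorem coords_zero (hp : p ∈ (chartAt E x₀).source) : coords x₀ (vec p (0 : T E p)) = 0 := by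
  simp only [coords_eq_continuousLinearMapAt hp, map_zero]

theorem coords_ofCoords (hp : p ∈ (chartAt E x₀).source) (e : E) :
    coords x₀ (vec p (ofCoords x₀ p e)) = e := by
  rw [coords, ofCoords, Trivialization.apply_mk_symm _ (mem_baseSet hp)]

theorem ofCoords_coords (hp : p ∈ (chartAt E x₀).source) (v : T E p) :
    ofCoords x₀ p (coords x₀ (vec p v)) = v :=
  Trivialization.symm_apply_apply_mk _ (mem_baseSet hp) v

theorem coords_injective (hp : p ∈ (chartAt E x₀).source) {v w : T E p}
    (h : coords x₀ (vec p v) = coords x₀ (vec p w)) : v = w := by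
  rw [← ofCoords_coords hp v, h, ofCoords_coords hp]

/-- The inverse of the chart of `TM` induced by the chart of `M` around `x₀`. -/
def tangentPoint (x₀ : M) (z : E × E) : TM E M :=
  vec ((extChartAt 𝓘(ℝ, E) x₀).symm z.1) (ofCoords x₀ ((extChartAt 𝓘(ℝ, E) x₀).symm z.1) z.2)

/-- The chart of `TM` induced by the chart of `M` around `x₀`. -/
def tangentCoords (x₀ : M) (v : TM E M) : E × E :=
  (extChartAt 𝓘(ℝ, E) x₀ v.proj, coords x₀ v)

theorem vec_ofCoords_congr {q : M} (h : p = q) (e : E) :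
    vec p (ofCoords x₀ p e) = vec q (ofCoords x₀ q e) := by
  subst h
  rfl

theorem tangentPoint_tangentCoords (hp : p ∈ (chartAt E x₀).source) (v : T E p) :
    tangentPoint x₀ (tangentCoords x₀ (vec p v)) = vec p v :=
  (vec_ofCoords_congr (symm_extChartAt hp) _).trans (congrArg (vec p) (ofCoords_coords hp v))

theorem tangentCoords_tangentPoint {z : E × E} (hz : z.1 ∈ (extChartAt 𝓘(ℝ, E) x₀).target) :
    tangentCoords x₀ (tangentPoint x₀ z) = z :=
  Prod.ext ((extChartAt 𝓘(ℝ, E) x₀).right_inv hz) (coords_ofCoords (symm_mem_chart_source hz) z.2)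

theorem contMDiffOn_tangentCoords (x₀ : M) :
    ContMDiffOn 𝓘(ℝ, E).tangent 𝓘(ℝ, E × E) ∞ (tangentCoords (E := E) x₀)
      {v : TM E M | v.proj ∈ (chartAt E x₀).source} := by
  refine ((contMDiffOn_extChartAt (I := 𝓘(ℝ, E).tangent) (n := ∞)
    (x := (vec x₀ (0 : T E x₀) : TM E M))).mono fun v hv => ?_).congr fun v _ => ?_
  · rwa [TangentBundle.mem_chart_source_iff]
  · rw [FiberBundle.extChartAt]
    simp [tangentCoords, coords]

theorem contMDiffOn_tangentPoint (x₀ : M) :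
    ContMDiffOn 𝓘(ℝ, E × E) 𝓘(ℝ, E).tangent ∞ (tangentPoint (E := E) x₀)
      ((extChartAt 𝓘(ℝ, E) x₀).target ×ˢ univ) := by
  refine ((contMDiffOn_extChartAt_symm (I := 𝓘(ℝ, E).tangent) (n := ∞)
    (vec x₀ (0 : T E x₀) : TM E M)).mono fun z hz => ?_).congr fun z hz => ?_
  · rw [FiberBundle.extChartAt_target]
    exact ⟨⟨hz.1, by simpa using symm_mem_chart_source hz.1⟩, mem_univ _⟩
  · rw [FiberBundle.extChartAt]
    exact Trivialization.mk_symm _ (mem_baseSet (symm_mem_chart_source hz.1)) z.2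

theorem mvfderiv_eq_of_hasFDerivAt (hp : p ∈ (chartAt E x₀).source) {f : M → ℝ} {h : E → ℝ}
    {h' : E →L[ℝ] ℝ} (hfh : ∀ᶠ q in 𝓝 p, f q = h (extChartAt 𝓘(ℝ, E) x₀ q))
    (hh : HasFDerivAt h h' (extChartAt 𝓘(ℝ, E) x₀ p)) (v : T E p) :
    mvfderiv 𝓘(ℝ, E) f p v = h' (coords x₀ (vec p v)) := by
  have hchart : MDifferentiableAt 𝓘(ℝ, E) 𝓘(ℝ, E) (extChartAt 𝓘(ℝ, E) x₀) p :=
    (contMDiffAt_extChartAt' (n := ∞) hp).mdifferentiableAt (by simp)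
  have hderiv : mfderiv 𝓘(ℝ, E) 𝓘(ℝ, ℝ) f p =
      mfderiv 𝓘(ℝ, E) 𝓘(ℝ, ℝ) (h ∘ extChartAt 𝓘(ℝ, E) x₀) p :=
    Filter.EventuallyEq.mfderiv_eq hfh
  rw [mfderiv_comp p hh.differentiableAt.mdifferentiableAt hchart, mfderiv_eq_fderiv,
    hh.fderiv] at hderiv
  rw [coords_eq_mfderiv hp]
  exact DFunLike.congr_fun hderiv v

section VectorFields

/-- The coordinate expression of a vector field in the chart around `x₀`. -/
def rep (x₀ : M) (X : ∀ p : M, T E p) (x : E) : E :=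
  coords x₀ (vec ((extChartAt 𝓘(ℝ, E) x₀).symm x) (X ((extChartAt 𝓘(ℝ, E) x₀).symm x)))

/-- The derivative along the tangent vector `ξ` of the coordinates of a vector field in the chart
around `x₀`. -/
def coordDeriv (x₀ : M) (X : ∀ p : M, T E p) (ξ : TM E M) : E :=
  fderiv ℝ (rep x₀ X) (extChartAt 𝓘(ℝ, E) x₀ ξ.proj) (coords x₀ ξ)

theorem rep_extChartAt (hp : p ∈ (chartAt E x₀).source) (X : ∀ p : M, T E p) :
    rep x₀ X (extChartAt 𝓘(ℝ, E) x₀ p) = coords x₀ (vec p (X p)) :=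
  congrArg (fun q => coords x₀ (vec q (X q))) (symm_extChartAt hp)

theorem contDiffAt_rep (hp : p ∈ (chartAt E x₀).source) (X : VField E M) :
    ContDiffAt ℝ ∞ (rep x₀ X) (extChartAt 𝓘(ℝ, E) x₀ p) := by
  have hsection : ContMDiffOn 𝓘(ℝ, E) 𝓘(ℝ, E).tangent ∞
      (fun x => vec ((extChartAt 𝓘(ℝ, E) x₀).symm x) (X ((extChartAt 𝓘(ℝ, E) x₀).symm x)))
      (extChartAt 𝓘(ℝ, E) x₀).target :=
    X.contMDiff.comp_contMDiffOn (contMDiffOn_extChartAt_symm x₀)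
  have hcoords := (contMDiffOn_tangentCoords x₀).comp hsection fun x hx => symm_mem_chart_source hx
  exact (contDiff_snd.contMDiff (𝕜 := ℝ) (E := E × E) (E' := E)).comp_contMDiffOn hcoords
    |>.contDiffOn.contDiffAt (target_mem_nhds hp)

theorem differentiableAt_rep (hp : p ∈ (chartAt E x₀).source) (X : VField E M) :
    DifferentiableAt ℝ (rep x₀ X) (extChartAt 𝓘(ℝ, E) x₀ p) :=
  (contDiffAt_rep hp X).differentiableAt (by simp)

theorem mpullback_symm_apply {x : E}
    (hx : x ∈ (extChartAt 𝓘(ℝ, E) x₀).target) (X : ∀ p : M, T E p) :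
    VectorField.mpullback 𝓘(ℝ, E) 𝓘(ℝ, E) (extChartAt 𝓘(ℝ, E) x₀).symm X x = rep x₀ X x := by
  have hright := mfderivWithin_extChartAt_symm_comp_mfderiv_extChartAt (I := 𝓘(ℝ, E)) hx
  have hleft := mfderiv_extChartAt_comp_mfderivWithin_extChartAt_symm (I := 𝓘(ℝ, E)) hx
  simp only [modelWithCornersSelf_coe, range_id, mfderivWithin_univ] at hright hleft
  rw [VectorField.mpullback_apply, ContinuousLinearMap.inverse_eq hright hleft, rep,
    coords_eq_mfderiv (symm_mem_chart_source hx)]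
  rfl

theorem mlieBracket_eq_lieBracket (X Y : E → E) :
    VectorField.mlieBracket 𝓘(ℝ, E) X Y = VectorField.lieBracket ℝ X Y :=
  VectorField.mlieBracketWithin_univ.symm.trans
    (VectorField.mlieBracketWithin_eq_lieBracketWithin.trans VectorField.lieBracketWithin_univ)

theorem coords_mlieBracket [CompleteSpace E] (hp : p ∈ (chartAt E x₀).source) (X Y : VField E M) :
    coords x₀ (vec p (VectorField.mlieBracket 𝓘(ℝ, E) X Y p)) =
      coordDeriv x₀ Y (vec p (X p)) - coordDeriv x₀ X (vec p (Y p)) := by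
  have hsmooth : minSmoothness ℝ 2 ≤ ∞ :=
    minSmoothness_of_isRCLikeNormedField.trans_le (WithTop.coe_le_coe.2 le_top)
  have : IsManifold 𝓘(ℝ, E) (minSmoothness ℝ 2) M := IsManifold.of_le hsmooth
  have hmdiff (Z : VField E M) : MDifferentiableAt 𝓘(ℝ, E) 𝓘(ℝ, E).tangent
      (fun q => vec q (Z q)) ((extChartAt 𝓘(ℝ, E) x₀).symm (extChartAt 𝓘(ℝ, E) x₀ p)) :=
    Z.contMDiff.mdifferentiable (by simp) _
  have hpullback (Z : VField E M) :
      VectorField.mpullback 𝓘(ℝ, E) 𝓘(ℝ, E) (extChartAt 𝓘(ℝ, E) x₀).symm Z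
        =ᶠ[𝓝 (extChartAt 𝓘(ℝ, E) x₀ p)] rep x₀ Z := by
    filter_upwards [target_mem_nhds hp] with x hx using mpullback_symm_apply hx Z
  have hnatural := VectorField.mpullback_mlieBracket (hmdiff X) (hmdiff Y)
    ((contMDiffOn_extChartAt_symm x₀).contMDiffAt (target_mem_nhds hp)) hsmooth
  rw [mpullback_symm_apply (extChartAt_mem_target hp), rep_extChartAt hp] at hnatural
  refine hnatural.trans ((congrFun (mlieBracket_eq_lieBracket _ _) _).trans
    ((Filter.EventuallyEq.lieBracket_vectorField_eq (hpullback X) (hpullback Y)).trans ?_))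
  simp only [VectorField.lieBracket, rep_extChartAt hp, coordDeriv]

end VectorFields

end Charts

section Metric

variable {E : Type*} [NormedAddCommGroup E] [NormedSpace ℝ E]
variable {M : Type*} [TopologicalSpace M] [ChartedSpace E M] [IsManifold 𝓘(ℝ, E) ∞ M]
variable {A : TopologicalSpace.Opens (TM E M)} {L : TM E M → ℝ} {x₀ p : M} {v : T E p}

/-- The coordinate expression, in the chart around `x₀`, of an open subset of `TM`. -/
def coordDomain (A : TopologicalSpace.Opens (TM E M)) (x₀ : M) : Set (E × E) :=
  {z | z.1 ∈ (extChartAt 𝓘(ℝ, E) x₀).target ∧ tangentPoint x₀ z ∈ A}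

/-- The coordinate expression, in the chart around `x₀`, of a function on `TM`. -/
def coordFun (L : TM E M → ℝ) (x₀ : M) (z : E × E) : ℝ := L (tangentPoint x₀ z)

theorem isOpen_coordDomain (A : TopologicalSpace.Opens (TM E M)) (x₀ : M) :
    IsOpen (coordDomain A x₀) := by
  convert (contMDiffOn_tangentPoint (E := E) x₀).continuousOn.isOpen_inter_preimage
    ((isOpen_extChartAt_target (I := 𝓘(ℝ, E)) x₀).prod isOpen_univ) A.isOpen using 1
  ext z
  simp [coordDomain]

theorem tangentCoords_mem_coordDomain (hp : p ∈ (chartAt E x₀).source) (hv : vec p v ∈ A) :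
    tangentCoords x₀ (vec p v) ∈ coordDomain A x₀ :=
  ⟨extChartAt_mem_target hp, by rwa [tangentPoint_tangentCoords hp]⟩

theorem coordFun_tangentCoords (hp : p ∈ (chartAt E x₀).source) (v : T E p) :
    coordFun L x₀ (tangentCoords x₀ (vec p v)) = L (vec p v) := by
  rw [coordFun, tangentPoint_tangentCoords hp]

theorem contDiffOn_coordFun (hL : ContMDiffOn 𝓘(ℝ, E).tangent 𝓘(ℝ, ℝ) ∞ L A) (x₀ : M) :
    ContDiffOn ℝ ∞ (coordFun L x₀) (coordDomain A x₀) :=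
  (hL.comp ((contMDiffOn_tangentPoint x₀).mono fun _ hz => ⟨hz.1, mem_univ _⟩)
    fun _ hz => hz.2).contDiffOn

theorem fundamentalTensor_eq (hL : ContMDiffOn 𝓘(ℝ, E).tangent 𝓘(ℝ, ℝ) ∞ L A)
    (hp : p ∈ (chartAt E x₀).source) (hv : vec p v ∈ A) (u w : T E p) :
    fundamentalTensor L (vec p v) u w =
      vertHess (coordFun L x₀) (tangentCoords x₀ (vec p v))
        (coords x₀ (vec p u)) (coords x₀ (vec p w)) := by
  have hℓ : ContDiffAt ℝ 2 (coordFun L x₀) (tangentCoords x₀ (vec p v)) :=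
    ((contDiffOn_coordFun hL x₀).contDiffAt ((isOpen_coordDomain A x₀).mem_nhds
      (tangentCoords_mem_coordDomain hp hv))).of_le (WithTop.coe_le_coe.2 le_top)
  rw [← deriv_deriv_eq_vertHess hℓ, fundamentalTensor]
  simp only [← coordFun_tangentCoords hp, tangentCoords, coords_add hp, coords_smul hp]

namespace IsPseudoFinslerMetric

theorem isLocalMetric (hL : IsPseudoFinslerMetric A L) (x₀ : M) :
    IsLocalMetric (coordDomain A x₀) (coordFun L x₀) where
  isOpen := isOpen_coordDomain A x₀
  smooth := contDiffOn_coordFun hL.smooth x₀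
  homogeneous z hz c hc := by
    have hp := symm_mem_chart_source hz.1
    have hscale := coordFun_tangentCoords (L := L) hp (c • ofCoords x₀ _ z.2)
    rw [tangentCoords, coords_smul hp, coords_ofCoords hp,
      (extChartAt 𝓘(ℝ, E) x₀).right_inv hz.1] at hscale
    exact hscale.trans (hL.homogeneous _ _ c hz.2 hc)
  nondegenerate z hz u hu := by
    have hp := symm_mem_chart_source hz.1
    have hzero : ofCoords x₀ _ u = (0 : T E _) := hL.nondegenerate _ _ hz.2 _ fun w => by
      rw [fundamentalTensor_eq hL.smooth hp hz.2, coords_ofCoords hp]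
      exact (congrArg (fun y => vertHess (coordFun L x₀) y u _)
        (tangentCoords_tangentPoint hz.1)).trans (hu _)
    rw [← coords_ofCoords hp u, hzero, coords_zero hp]

theorem verticalDeriv_eq (hL : IsPseudoFinslerMetric A L) (hp : p ∈ (chartAt E x₀).source)
    (hv : vec p v ∈ A) (a u w : T E p) :
    verticalDeriv L (vec p v) a u w =
      vertDeriv (coordFun L x₀) (tangentCoords x₀ (vec p v)) (coords x₀ (vec p a))
        (coords x₀ (vec p u)) (coords x₀ (vec p w)) := by
  have hz := tangentCoords_mem_coordDomain hp hv
  have hline (t : ℝ) : tangentCoords x₀ (vec p (v + t • a)) = ((tangentCoords x₀ (vec p v)).1,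
      (tangentCoords x₀ (vec p v)).2 + t • coords x₀ (vec p a)) := by
    simp only [tangentCoords, coords_add hp, coords_smul hp]
  have hcont : ContinuousAt (fun t : ℝ => tangentCoords x₀ (vec p (v + t • a))) 0 := by
    simp only [hline]
    fun_prop
  have hmem : ∀ᶠ t : ℝ in 𝓝 0, tangentCoords x₀ (vec p (v + t • a)) ∈ coordDomain A x₀ :=
    hcont.eventually_mem ((isOpen_coordDomain A x₀).mem_nhds (by simpa using hz))
  refine (Filter.EventuallyEq.deriv_eq ?_).trans
    ((hL.isLocalMetric x₀).hasDerivAt_vertHess_vertical_line hz _ _ _).deriv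
  filter_upwards [hmem] with t ht
  have hvt : vec p (v + t • a) ∈ A := by
    rw [← tangentPoint_tangentCoords hp]
    exact ht.2
  rw [← hline]
  exact fundamentalTensor_eq hL.smooth hp hvt u w

theorem mvfderiv_fundamentalTensor (hL : IsPseudoFinslerMetric A L)
    (hp : p ∈ (chartAt E x₀).source) (Y Z V : VField E M) (hV : V p = v) (hv : vec p v ∈ A)
    (ξ : T E p) :
    let ℓ := coordFun L x₀
    let z := tangentCoords x₀ (vec p v)
    let y := coords x₀ (vec p (Y p))
    let w := coords x₀ (vec p (Z p))
    mvfderiv 𝓘(ℝ, E) (fun q => fundamentalTensor L (vec q (V q)) (Y q) (Z q)) p ξ =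
      horizDeriv ℓ z (coords x₀ (vec p ξ)) y w + vertDeriv ℓ z (coordDeriv x₀ V (vec p ξ)) y w
        + vertHess ℓ z (coordDeriv x₀ Y (vec p ξ)) w
        + vertHess ℓ z y (coordDeriv x₀ Z (vec p ξ)) := by
  subst hV
  intro ℓ z y w
  have hz : (extChartAt 𝓘(ℝ, E) x₀ p, rep x₀ V (extChartAt 𝓘(ℝ, E) x₀ p)) = z :=
    Prod.ext rfl (rep_extChartAt hp V)
  have hrep (X : VField E M) :=
    (differentiableAt_rep hp X).hasFDerivAt.hasFDerivWithinAt (s := univ)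
  have hg : DifferentiableAt ℝ (vertHess ℓ)
      (extChartAt 𝓘(ℝ, E) x₀ p, rep x₀ V (extChartAt 𝓘(ℝ, E) x₀ p)) := by
    rw [hz]
    exact (hL.isLocalMetric x₀).differentiableAt_vertHess (tangentCoords_mem_coordDomain hp hv)
  obtain ⟨d, hd, hd_apply⟩ := exists_hasFDerivWithinAt_vertHess_apply (c := fun x => x) hg
    (hasFDerivWithinAt_id _ _) (hrep V) (hrep Y) (hrep Z)
  have hmem : ∀ᶠ q in 𝓝 p, vec q (V q) ∈ A :=
    V.contMDiff.continuous.continuousAt.eventually_mem (A.isOpen.mem_nhds hv)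
  have hlocal : ∀ᶠ q in 𝓝 p, fundamentalTensor L (vec q (V q)) (Y q) (Z q) =
      (fun x => vertHess ℓ (x, rep x₀ V x) (rep x₀ Y x) (rep x₀ Z x))
        (extChartAt 𝓘(ℝ, E) x₀ q) := by
    filter_upwards [hmem, (chartAt E x₀).open_source.mem_nhds hp] with q hq hqs
    simp only [rep_extChartAt hqs]
    exact fundamentalTensor_eq hL.smooth hqs hq _ _
  rw [mvfderiv_eq_of_hasFDerivAt hp hlocal hd.hasFDerivAt_of_univ, hd_apply]
  simp only [rep_extChartAt hp]
  rfl

end IsPseudoFinslerMetric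

end Metric

section Tensoriality

variable {E : Type*} [NormedAddCommGroup E] [NormedSpace ℝ E]
variable {M : Type*} [TopologicalSpace M] [ChartedSpace E M] [IsManifold 𝓘(ℝ, E) ∞ M] {x₀ p : M}

theorem fmul_apply (f : SFun E M) (X : VField E M) (p : M) : fmul f X p = f p • X p := rfl

theorem sum_field_apply {ι : Type*} (s : Finset ι) (X : ι → VField E M) (p : M) :
    (∑ i ∈ s, X i) p = ∑ i ∈ s, X i p :=
  (congrFun (map_sum (ContMDiffSection.coeAddHom 𝓘(ℝ, E) E ∞ (TangentSpace 𝓘(ℝ, E) : M → Type _))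
    X s) p).trans (Finset.sum_apply _ _ _)

theorem coords_sum {ι : Type*} (hp : p ∈ (chartAt E x₀).source) (s : Finset ι) (v : ι → T E p) :
    coords x₀ (vec p (∑ i ∈ s, v i)) = ∑ i ∈ s, coords x₀ (vec p (v i)) := by
  simp only [coords_eq_continuousLinearMapAt hp, map_sum]

theorem coordDeriv_vec_add (hp : p ∈ (chartAt E x₀).source) (X : ∀ p : M, T E p) (ξ η : T E p) :
    coordDeriv x₀ X (vec p (ξ + η)) = coordDeriv x₀ X (vec p ξ) + coordDeriv x₀ X (vec p η) := by
  simp only [coordDeriv, coords_add hp, map_add]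

theorem coordDeriv_vec_smul (hp : p ∈ (chartAt E x₀).source) (X : ∀ p : M, T E p) (c : ℝ)
    (ξ : T E p) : coordDeriv x₀ X (vec p (c • ξ)) = c • coordDeriv x₀ X (vec p ξ) := by
  simp only [coordDeriv, coords_smul hp, map_smul]

theorem coordDeriv_add (hp : p ∈ (chartAt E x₀).source) (X Y : VField E M) (ξ : T E p) :
    coordDeriv x₀ ⇑(X + Y) (vec p ξ) = coordDeriv x₀ X (vec p ξ) + coordDeriv x₀ Y (vec p ξ) := by
  have hrep : rep x₀ ⇑(X + Y) =ᶠ[𝓝 (extChartAt 𝓘(ℝ, E) x₀ p)]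
      fun x => rep x₀ X x + rep x₀ Y x := by
    filter_upwards [target_mem_nhds hp] with x hx using coords_add (symm_mem_chart_source hx) _ _
  rw [coordDeriv, hrep.fderiv_eq, fderiv_fun_add (differentiableAt_rep hp X)
    (differentiableAt_rep hp Y)]
  rfl

theorem differentiableAt_comp_symm (hp : p ∈ (chartAt E x₀).source) (f : SFun E M) :
    DifferentiableAt ℝ (fun x => f ((extChartAt 𝓘(ℝ, E) x₀).symm x))
      (extChartAt 𝓘(ℝ, E) x₀ p) :=
  ((f.contMDiff.comp_contMDiffOn (contMDiffOn_extChartAt_symm x₀)).contDiffOn.contDiffAt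
    (target_mem_nhds hp)).differentiableAt (by simp)

theorem coordDeriv_fmul (hp : p ∈ (chartAt E x₀).source) (f : SFun E M) (X : VField E M)
    (ξ : T E p) :
    coordDeriv x₀ (fmul f X) (vec p ξ) =
      mvfderiv 𝓘(ℝ, E) f p ξ • coords x₀ (vec p (X p)) + f p • coordDeriv x₀ X (vec p ξ) := by
  have hrep : rep x₀ (fmul f X) =ᶠ[𝓝 (extChartAt 𝓘(ℝ, E) x₀ p)]
      fun x => f ((extChartAt 𝓘(ℝ, E) x₀).symm x) • rep x₀ X x := by
    filter_upwards [target_mem_nhds hp] with x hx using coords_smul (symm_mem_chart_source hx) _ _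
  have hf := differentiableAt_comp_symm hp f
  have hlocal : ∀ᶠ q in 𝓝 p,
      f q = f ((extChartAt 𝓘(ℝ, E) x₀).symm (extChartAt 𝓘(ℝ, E) x₀ q)) := by
    filter_upwards [(chartAt E x₀).open_source.mem_nhds hp] with q hq
    rw [symm_extChartAt hq]
  rw [coordDeriv, hrep.fderiv_eq, fderiv_fun_smul hf (differentiableAt_rep hp X),
    mvfderiv_eq_of_hasFDerivAt hp hlocal hf.hasFDerivAt, rep_extChartAt hp, symm_extChartAt hp,
    coordDeriv]
  exact add_comm _ _

theorem contMDiffOn_coords (x₀ : M) (X : VField E M) :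
    ContMDiffOn 𝓘(ℝ, E) 𝓘(ℝ, E) ∞ (fun q => coords x₀ (vec q (X q))) (chartAt E x₀).source :=
  (contDiff_snd.contMDiff (𝕜 := ℝ) (E := E × E) (E' := E)).comp_contMDiffOn
    ((contMDiffOn_tangentCoords x₀).comp X.contMDiff.contMDiffOn fun _ hq => hq)

variable [FiniteDimensional ℝ E] [T2Space M]

theorem coordField_eventuallyEq (hp : p ∈ (chartAt E x₀).source) (e : E) :
    ∀ᶠ q in 𝓝 p, coordField x₀ p e q = ofCoords x₀ q e := by
  rw [coordField, dif_pos hp]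
  exact (exists_coordField x₀ p hp e).choose_spec

theorem coordField_self (hp : p ∈ (chartAt E x₀).source) (e : E) :
    coordField x₀ p e p = ofCoords x₀ p e :=
  (coordField_eventuallyEq hp e).self_of_nhds

theorem coords_coordField (hp : p ∈ (chartAt E x₀).source) (e : E) :
    coords x₀ (vec p (coordField x₀ p e p)) = e := by
  rw [coordField_self hp, coords_ofCoords hp]

theorem coordField_coords (hp : p ∈ (chartAt E x₀).source) (v : T E p) :
    coordField x₀ p (coords x₀ (vec p v)) p = v := by
  rw [coordField_self hp, ofCoords_coords hp]

theorem rep_coordField_eventuallyEq (hp : p ∈ (chartAt E x₀).source) (e : E) :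
    rep x₀ (coordField x₀ p e) =ᶠ[𝓝 (extChartAt 𝓘(ℝ, E) x₀ p)] fun _ => e := by
  have hcont : Tendsto (extChartAt 𝓘(ℝ, E) x₀).symm (𝓝 (extChartAt 𝓘(ℝ, E) x₀ p)) (𝓝 p) := by
    simpa only [ContinuousAt, symm_extChartAt hp] using
      (continuousOn_extChartAt_symm x₀).continuousAt (target_mem_nhds hp)
  filter_upwards [hcont.eventually (coordField_eventuallyEq hp e), target_mem_nhds hp]
    with x hx hxt
  rw [rep, hx, coords_ofCoords (symm_mem_chart_source hxt)]

theorem coordDeriv_coordField (hp : p ∈ (chartAt E x₀).source) (e : E) (ξ : T E p) :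
    coordDeriv x₀ (coordField x₀ p e) (vec p ξ) = 0 := by
  rw [coordDeriv, (rep_coordField_eventuallyEq hp e).fderiv_eq, fderiv_fun_const]
  rfl

theorem exists_bump {U : Set M} (hU : U ∈ 𝓝 p) :
    ∃ f : SFun E M, (∀ᶠ q in 𝓝 p, f q = 1) ∧ tsupport f ⊆ U := by
  obtain ⟨f, -, hf⟩ := (SmoothBumpFunction.nhds_basis_tsupport (I := 𝓘(ℝ, E)) p).mem_iff.1 hU
  exact ⟨⟨f, f.contMDiff⟩, f.eventuallyEq_one, hf⟩

theorem exists_extension {U : Set M} (hU : IsOpen U) (hp : p ∈ U) {g : M → ℝ}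
    (hg : ContMDiffOn 𝓘(ℝ, E) 𝓘(ℝ, ℝ) ∞ g U) :
    ∃ f : SFun E M, ∀ᶠ q in 𝓝 p, f q = g q := by
  obtain ⟨ψ, hψ_one, hψ_supp⟩ := exists_bump (E := E) (hU.mem_nhds hp)
  refine ⟨⟨fun q => ψ q • g q, contMDiff_of_tsupport fun q hq => ?_⟩, ?_⟩
  · have hqU : q ∈ U := hψ_supp (tsupport_smul_subset_left _ _ hq)
    exact ψ.contMDiff.contMDiffAt.smul (hg.contMDiffAt (hU.mem_nhds hqU))
  · filter_upwards [hψ_one] with q hq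
    change ψ q • g q = g q
    rw [hq, one_smul]

theorem exists_eventuallyEq_sum_fmul_coordField {ι : Type*} [Fintype ι] (b : Module.Basis ι ℝ E)
    (p : M) (X : VField E M) :
    ∃ f : ι → SFun E M, (∀ᶠ q in 𝓝 p, X q = (∑ i, fmul (f i) (coordField p p (b i))) q) ∧
      ∀ i, f i p = b.coord i (coords p (vec p (X p))) := by
  have hp : p ∈ (chartAt E p).source := mem_chart_source E p
  have hext (i : ι) : ∃ f : SFun E M, ∀ᶠ q in 𝓝 p, f q = b.coord i (coords p (vec q (X q))) :=
    exists_extension (chartAt E p).open_source hp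
      ((b.coord i).toContinuousLinearMap.contMDiff.comp_contMDiffOn (contMDiffOn_coords p X))
  choose f hf using hext
  refine ⟨f, ?_, fun i => (hf i).self_of_nhds⟩
  filter_upwards [eventually_all.2 hf, eventually_all.2 fun i => coordField_eventuallyEq hp (b i),
    (chartAt E p).open_source.mem_nhds hp] with q hfq hframe hq
  refine coords_injective hq ?_
  simp only [sum_field_apply, fmul_apply, coords_sum hq, coords_smul hq, hframe,
    coords_ofCoords hq, hfq]
  exact (b.sum_repr _).symm

section LinearAtPoint

variable {F : Type*} [AddCommGroup F] [Module ℝ F]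

theorem apply_eq_of_eventuallyEq {Φ : VField E M → F}
    (hΦ : ∀ (f : SFun E M) (X : VField E M), Φ (fmul f X) = f p • Φ X) {X Y : VField E M}
    (hXY : ∀ᶠ q in 𝓝 p, X q = Y q) : Φ X = Φ Y := by
  obtain ⟨ψ, hψ_one, hψ_supp⟩ := exists_bump (E := E) hXY
  have hmul : fmul ψ X = fmul ψ Y := by
    ext q
    rw [fmul_apply, fmul_apply]
    by_cases hq : q ∈ tsupport ψ
    · rw [hψ_supp hq]
    · rw [image_eq_zero_of_notMem_tsupport hq, zero_smul, zero_smul]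
  simpa only [hΦ, hψ_one.self_of_nhds, one_smul] using congrArg Φ hmul

theorem apply_eq_of_apply_eq (Φ : VField E M →+ F)
    (hΦ : ∀ (f : SFun E M) (X : VField E M), Φ (fmul f X) = f p • Φ X) {X Y : VField E M}
    (hXY : X p = Y p) : Φ X = Φ Y := by
  have hzero : (X - Y) p = 0 := sub_eq_zero.2 hXY
  obtain ⟨f, hf, hf_apply⟩ :=
    exists_eventuallyEq_sum_fmul_coordField (Module.finBasis ℝ E) p (X - Y)
  rw [← sub_eq_zero, ← map_sub, apply_eq_of_eventuallyEq hΦ hf, map_sum]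
  refine Finset.sum_eq_zero fun i _ => ?_
  rw [hΦ, hf_apply, hzero, coords_zero (mem_chart_source E p), map_zero, zero_smul]

end LinearAtPoint

end Tensoriality

section DerivativesAtPoint

variable {E : Type*} [NormedAddCommGroup E] [NormedSpace ℝ E]
variable {M : Type*} [TopologicalSpace M] [ChartedSpace E M] [IsManifold 𝓘(ℝ, E) ∞ M]
variable {A : TopologicalSpace.Opens (TM E M)} {L : TM E M → ℝ} {x₀ p : M} {v : T E p}
variable {N N' : VField E M → VField E M → T E p} {Γ : E →L[ℝ] E →L[ℝ] E}

/-- `N`, which plays the role of `(X, Y) ↦ ∇^v_X Y` for a fixed vector `v`, has the Christoffel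
symbols `Γ` in the chart around `x₀`. -/
def HasSymbolAt (x₀ : M) (N : VField E M → VField E M → T E p) (Γ : E →L[ℝ] E →L[ℝ] E) : Prop :=
  ∀ X Y : VField E M, coords x₀ (vec p (N X Y)) =
    coordDeriv x₀ Y (vec p (X p)) + Γ (coords x₀ (vec p (X p))) (coords x₀ (vec p (Y p)))

/-- The torsion of `N`, which plays the role of `(X, Y) ↦ ∇^v_X Y` for a fixed vector `v`,
vanishes. -/
def IsTorsionFreeAt (N : VField E M → VField E M → T E p) : Prop :=
  ∀ X Y : VField E M, N X Y - N Y X = VectorField.mlieBracket 𝓘(ℝ, E) X Y p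

/-- The condition `∇g = 0` at the vector `v`, for a map `N` that plays the role of
`(X, Y) ↦ ∇^v_X Y`. -/
def IsMetricAt (L : TM E M → ℝ) (v : T E p) (N : VField E M → VField E M → T E p) : Prop :=
  ∀ X Y Z V : VField E M, V p = v →
    mvfderiv 𝓘(ℝ, E) (fun q => fundamentalTensor L (vec q (V q)) (Y q) (Z q)) p (X p) =
      verticalDeriv L (vec p v) (N X V) (Y p) (Z p)
        + fundamentalTensor L (vec p v) (N X Y) (Z p)
        + fundamentalTensor L (vec p v) (Y p) (N X Z)

namespace HasSymbolAt

theorem add_right (hN : HasSymbolAt x₀ N Γ) (hp : p ∈ (chartAt E x₀).source)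
    (X Y Z : VField E M) : N X (Y + Z) = N X Y + N X Z := by
  refine coords_injective hp ?_
  rw [coords_add hp, hN, hN, hN, coordDeriv_add hp, ContMDiffSection.coe_add, Pi.add_apply,
    coords_add hp, map_add]
  abel

theorem leibniz (hN : HasSymbolAt x₀ N Γ) (hp : p ∈ (chartAt E x₀).source)
    (f : SFun E M) (X Y : VField E M) :
    N X (fmul f Y) = mvfderiv 𝓘(ℝ, E) f p (X p) • Y p + f p • N X Y := by
  refine coords_injective hp ?_
  rw [coords_add hp, coords_smul hp, coords_smul hp, hN, hN, coordDeriv_fmul hp, fmul_apply,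
    coords_smul hp, map_smul]
  module

theorem linear_left (hN : HasSymbolAt x₀ N Γ) (hp : p ∈ (chartAt E x₀).source)
    (f h : SFun E M) (X Y Z : VField E M) :
    N (fmul f X + fmul h Y) Z = f p • N X Z + h p • N Y Z := by
  refine coords_injective hp ?_
  rw [coords_add hp, coords_smul hp, coords_smul hp, hN, hN, hN, ContMDiffSection.coe_add,
    Pi.add_apply, fmul_apply, fmul_apply]
  simp only [coordDeriv_vec_add hp, coordDeriv_vec_smul hp, coords_add hp, coords_smul hp,
    map_add, map_smul, add_apply, smul_apply]
  module

variable [FiniteDimensional ℝ E] [T2Space M]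

theorem isTorsionFreeAt_iff (hN : HasSymbolAt x₀ N Γ) (hp : p ∈ (chartAt E x₀).source) :
    IsTorsionFreeAt N ↔ ∀ u w, Γ u w = Γ w u := by
  have := FiniteDimensional.complete ℝ E
  have hcoords (X Y : VField E M) : N X Y - N Y X = VectorField.mlieBracket 𝓘(ℝ, E) X Y p ↔
      Γ (coords x₀ (vec p (X p))) (coords x₀ (vec p (Y p))) =
        Γ (coords x₀ (vec p (Y p))) (coords x₀ (vec p (X p))) := by
    have hinj (v w : T E p) : v = w ↔ coords x₀ (vec p v) = coords x₀ (vec p w) :=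
      ⟨fun h => h ▸ rfl, coords_injective hp⟩
    rw [hinj, coords_sub hp, hN, hN, coords_mlieBracket hp, add_sub_add_comm, add_eq_left,
      sub_eq_zero]
  refine ⟨fun h u w => ?_, fun h X Y => (hcoords X Y).2 (h _ _)⟩
  simpa only [coords_coordField hp] using
    (hcoords (coordField x₀ p u) (coordField x₀ p w)).1 (h _ _)

theorem isMetricAt_iff (hN : HasSymbolAt x₀ N Γ) (hL : IsPseudoFinslerMetric A L)
    (hp : p ∈ (chartAt E x₀).source) (hv : vec p v ∈ A) :
    IsMetricAt L v N ↔
      IsCompatibleAt (coordFun L x₀) (tangentCoords x₀ (vec p v)) Γ := by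
  set ℓ := coordFun L x₀
  set z := tangentCoords x₀ (vec p v)
  have hcoords (X Y Z V : VField E M) (hV : V p = v) :
      mvfderiv 𝓘(ℝ, E) (fun q => fundamentalTensor L (vec q (V q)) (Y q) (Z q)) p (X p) =
        verticalDeriv L (vec p v) (N X V) (Y p) (Z p)
          + fundamentalTensor L (vec p v) (N X Y) (Z p)
          + fundamentalTensor L (vec p v) (Y p) (N X Z) ↔
      let u := coords x₀ (vec p (X p))
      let y := coords x₀ (vec p (Y p))
      let w := coords x₀ (vec p (Z p))
      horizDeriv ℓ z u y w =
        vertDeriv ℓ z (Γ u (coords x₀ (vec p v))) y w + vertHess ℓ z (Γ u y) w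
          + vertHess ℓ z y (Γ u w) := by
    rw [hL.mvfderiv_fundamentalTensor hp Y Z V hV hv, hL.verticalDeriv_eq hp hv,
      fundamentalTensor_eq hL.smooth hp hv, fundamentalTensor_eq hL.smooth hp hv, hN, hN, hN, hV]
    simp only [map_add, add_apply]
    constructor <;> intro h <;> linear_combination h
  refine ⟨fun h u y w => ?_, fun h X Y Z V hV => (hcoords X Y Z V hV).2 (h _ _ _)⟩
  have hframe := (hcoords (coordField x₀ p u) (coordField x₀ p y) (coordField x₀ p w) _
    (coordField_coords hp v)).1 (h _ _ _ _ (coordField_coords hp v))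
  simp only [coords_coordField hp] at hframe
  exact hframe

end HasSymbolAt

variable [FiniteDimensional ℝ E] [T2Space M]

theorem IsTorsionFreeAt.eq_of_isMetricAt (hN : IsTorsionFreeAt N) (hN' : IsTorsionFreeAt N')
    (hL : IsPseudoFinslerMetric A L) (hv : vec p v ∈ A) (hm : IsMetricAt L v N)
    (hm' : IsMetricAt L v N') : N = N' := by
  have hp : p ∈ (chartAt E p).source := mem_chart_source E p
  funext X Y
  refine coords_injective hp (sub_eq_zero.1 ?_)
  refine ((hL.isLocalMetric p).isChernData (tangentCoords_mem_coordDomain hp hv)).difference_eq_zero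
    (val := fun X : VField E M => coords p (vec p (X p)))
    (B := fun X Y => coords p (vec p (N X Y)) - coords p (vec p (N' X Y)))
    (r := coordField p p (coords p (vec p v)))
    (fun e => ⟨coordField p p e, coords_coordField hp e⟩) (coords_coordField hp _)
    (fun X Y => ?_) (fun X Y Z => ?_) X Y
  · have htorsion := (hN X Y).trans (hN' X Y).symm
    rw [sub_eq_sub_iff_sub_eq_sub, ← coords_sub hp, htorsion, coords_sub hp]
  · have hmetric := (hm X Y Z _ (coordField_coords hp v)).symm.trans
      (hm' X Y Z _ (coordField_coords hp v))
    simp only [hL.verticalDeriv_eq hp hv, fundamentalTensor_eq hL.smooth hp hv] at hmetric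
    simp only [map_sub, sub_apply]
    linear_combination hmetric

end DerivativesAtPoint

namespace Connection

section Symbols

variable {E : Type*} [NormedAddCommGroup E] [NormedSpace ℝ E]
variable {M : Type*} [TopologicalSpace M] [ChartedSpace E M] [IsManifold 𝓘(ℝ, E) ∞ M]
variable {A : TopologicalSpace.Opens (TM E M)} {x₀ p : M} {v : T E p}

theorem fmul_one (X : VField E M) : fmul 1 X = X := by
  ext p
  exact one_smul ℝ (X p)

theorem fmul_zero (X : VField E M) : fmul 0 X = 0 := by
  ext p
  exact zero_smul ℝ (X p)

theorem add_left (D : Connection A) (X Y Z : VField E M) (v : A) :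
    D.toFun (X + Y) Z v = D.toFun X Z v + D.toFun Y Z v := by
  have h := D.linear_left 1 1 X Y Z v
  rw [fmul_one, fmul_one] at h
  exact h.trans (congrArg₂ _ (one_smul ℝ _) (one_smul ℝ _))

theorem fmul_left (D : Connection A) (f : SFun E M) (X Z : VField E M) (v : A) :
    D.toFun (fmul f X) Z v = f v.1.proj • D.toFun X Z v := by
  have h := D.linear_left f 0 X X Z v
  rw [fmul_zero, add_zero] at h
  exact h.trans (add_eq_left.2 (zero_smul ℝ _))

variable [FiniteDimensional ℝ E] [T2Space M]

theorem toFun_eq_of_apply_eq_left (D : Connection A) (v : A) {X Y : VField E M}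
    (hXY : X v.1.proj = Y v.1.proj) (Z : VField E M) : D.toFun X Z v = D.toFun Y Z v :=
  apply_eq_of_apply_eq (AddMonoidHom.mk' (fun X => D.toFun X Z v) fun X Y => D.add_left X Y Z v)
    (fun f X => D.fmul_left f X Z v) hXY

theorem coords_toFun_sub_coordDeriv_eq (D : Connection A) (hp : p ∈ (chartAt E x₀).source)
    (hv : vec p v ∈ A) (X : VField E M) {Y Z : VField E M} (hYZ : Y p = Z p) :
    coords x₀ (vec p (D.toFun X Y ⟨vec p v, hv⟩)) - coordDeriv x₀ Y (vec p (X p)) =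
      coords x₀ (vec p (D.toFun X Z ⟨vec p v, hv⟩)) - coordDeriv x₀ Z (vec p (X p)) := by
  let Φ : VField E M →+ E := AddMonoidHom.mk'
    (fun Y => coords x₀ (vec p (D.toFun X Y ⟨vec p v, hv⟩)) - coordDeriv x₀ Y (vec p (X p)))
    fun Y Z => by
      rw [D.add_right, coords_add hp, coordDeriv_add hp]
      abel
  refine apply_eq_of_apply_eq Φ (fun f Y => ?_) hYZ
  simp only [Φ, AddMonoidHom.mk'_apply]
  rw [D.leibniz, coordDeriv_fmul hp, coords_add hp, coords_smul hp, coords_smul hp]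
  module

theorem coords_toFun (D : Connection A) (hp : p ∈ (chartAt E x₀).source) (hv : vec p v ∈ A)
    (X Y : VField E M) :
    coords x₀ (vec p (D.toFun X Y ⟨vec p v, hv⟩)) = coordDeriv x₀ Y (vec p (X p))
      + D.christoffel x₀ ⟨vec p v, hv⟩ (coords x₀ (vec p (X p))) (coords x₀ (vec p (Y p))) := by
  have hY := D.coords_toFun_sub_coordDeriv_eq hp hv X (coordField_coords hp (Y p)).symm
  have hX := D.toFun_eq_of_apply_eq_left ⟨vec p v, hv⟩ (coordField_coords hp (X p)).symm
    (coordField x₀ p (coords x₀ (vec p (Y p))))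
  rw [coordDeriv_coordField hp, sub_zero, hX] at hY
  exact sub_eq_iff_eq_add'.1 hY

theorem christoffel_add_left (D : Connection A) (hp : p ∈ (chartAt E x₀).source)
    (hv : vec p v ∈ A) (u u' w : E) :
    D.christoffel x₀ ⟨vec p v, hv⟩ (u + u') w =
      D.christoffel x₀ ⟨vec p v, hv⟩ u w + D.christoffel x₀ ⟨vec p v, hv⟩ u' w := by
  have h := D.coords_toFun hp hv (coordField x₀ p u + coordField x₀ p u') (coordField x₀ p w)
  rw [D.add_left, coords_add hp, coordDeriv_coordField hp, ContMDiffSection.coe_add, Pi.add_apply,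
    coords_add hp, coords_coordField hp, coords_coordField hp, coords_coordField hp, zero_add] at h
  exact h.symm

theorem christoffel_smul_left (D : Connection A) (hp : p ∈ (chartAt E x₀).source)
    (hv : vec p v ∈ A) (c : ℝ) (u w : E) :
    D.christoffel x₀ ⟨vec p v, hv⟩ (c • u) w = c • D.christoffel x₀ ⟨vec p v, hv⟩ u w := by
  have h := D.coords_toFun hp hv (fmul (ContMDiffMap.const c) (coordField x₀ p u))
    (coordField x₀ p w)
  rw [D.fmul_left, coords_smul hp, coordDeriv_coordField hp, fmul_apply, coords_smul hp,
    coords_coordField hp, coords_coordField hp, zero_add] at h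
  exact h.symm

theorem christoffel_add_right (D : Connection A) (hp : p ∈ (chartAt E x₀).source)
    (hv : vec p v ∈ A) (u w w' : E) :
    D.christoffel x₀ ⟨vec p v, hv⟩ u (w + w') =
      D.christoffel x₀ ⟨vec p v, hv⟩ u w + D.christoffel x₀ ⟨vec p v, hv⟩ u w' := by
  have h := D.coords_toFun hp hv (coordField x₀ p u) (coordField x₀ p w + coordField x₀ p w')
  rw [D.add_right, coords_add hp, coordDeriv_add hp, coordDeriv_coordField hp,
    coordDeriv_coordField hp, ContMDiffSection.coe_add, Pi.add_apply, coords_add hp,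
    coords_coordField hp, coords_coordField hp, coords_coordField hp, add_zero, zero_add] at h
  exact h.symm

theorem christoffel_smul_right (D : Connection A) (hp : p ∈ (chartAt E x₀).source)
    (hv : vec p v ∈ A) (c : ℝ) (u w : E) :
    D.christoffel x₀ ⟨vec p v, hv⟩ u (c • w) = c • D.christoffel x₀ ⟨vec p v, hv⟩ u w := by
  have h := D.coords_toFun hp hv (coordField x₀ p u)
    (fmul (ContMDiffMap.const c) (coordField x₀ p w))
  rw [D.leibniz, coords_add hp, coords_smul hp, coords_smul hp, coordDeriv_fmul hp,
    coordDeriv_coordField hp, smul_zero, add_zero, fmul_apply, coords_smul hp,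
    coords_coordField hp, coords_coordField hp] at h
  exact (add_left_cancel h).symm

/-- The Christoffel symbols at `v` in the chart around `x₀`, as a bilinear map. -/
def symbolAt (D : Connection A) (hp : p ∈ (chartAt E x₀).source) (hv : vec p v ∈ A) :
    E →L[ℝ] E →L[ℝ] E :=
  LinearMap.toContinuousLinearMap (LinearMap.toContinuousLinearMap.toLinearMap ∘ₗ
    LinearMap.mk₂ ℝ (D.christoffel x₀ ⟨vec p v, hv⟩) (D.christoffel_add_left hp hv)
      (D.christoffel_smul_left hp hv) (D.christoffel_add_right hp hv)
      (D.christoffel_smul_right hp hv))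

open Classical in
/-- The Christoffel symbols in the chart around `x₀`, as a function of the coordinates of the
tangent vector, with the value `0` outside the domain of the connection. -/
def symbol (D : Connection A) (x₀ : M) (z : E × E) : E →L[ℝ] E →L[ℝ] E :=
  if hz : z ∈ coordDomain A x₀ then D.symbolAt (symm_mem_chart_source hz.1) hz.2 else 0

theorem symbol_tangentCoords (D : Connection A) (hp : p ∈ (chartAt E x₀).source)
    (hv : vec p v ∈ A) (u w : E) :
    D.symbol x₀ (tangentCoords x₀ (vec p v)) u w = D.christoffel x₀ ⟨vec p v, hv⟩ u w := by
  rw [symbol, dif_pos (tangentCoords_mem_coordDomain hp hv)]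
  exact congrArg (D.christoffel x₀ · u w) (Subtype.ext (tangentPoint_tangentCoords hp v))

theorem hasSymbolAt (D : Connection A) (hp : p ∈ (chartAt E x₀).source) (hv : vec p v ∈ A) :
    HasSymbolAt x₀ (fun X Y => D.toFun X Y ⟨vec p v, hv⟩)
      (D.symbol x₀ (tangentCoords x₀ (vec p v))) := fun X Y => by
  rw [D.symbol_tangentCoords hp hv]
  exact D.coords_toFun hp hv X Y

theorem contDiffOn_coords_toFun (D : Connection A) (x₀ : M) (X Y : VField E M) :
    ContDiffOn ℝ ∞ (fun z => fderiv ℝ (rep x₀ Y) z.1 (rep x₀ X z.1)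
      + D.symbol x₀ z (rep x₀ X z.1) (rep x₀ Y z.1)) (coordDomain A x₀) := by
  let g : A → E := fun v => coords x₀ (vec v.1.proj (D.toFun X Y v))
  have hg (z : coordDomain A x₀) : ContMDiffAt 𝓘(ℝ, E).tangent 𝓘(ℝ, E) ∞
      (Function.extend Subtype.val g 0) (tangentPoint x₀ z.1) := by
    refine (contMDiffAt_subtype_iff (U := A) (x := ⟨tangentPoint x₀ z.1, z.2.2⟩)).1 ?_
    simp only [Subtype.val_injective.extend_apply]
    exact ((Trivialization.contMDiffAt_iff (e := trivializationAt E (TangentSpace 𝓘(ℝ, E)) x₀)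
      ((Trivialization.mem_source _).2 (mem_baseSet (symm_mem_chart_source z.2.1)))).1
        (D.smooth X Y _)).2
  have hcomp : ContDiffOn ℝ ∞ (Function.extend Subtype.val g 0 ∘ tangentPoint x₀)
      (coordDomain A x₀) := fun z hz =>
    ((hg ⟨z, hz⟩).comp_contMDiffWithinAt z ((contMDiffOn_tangentPoint x₀).mono
      (fun _ hz => ⟨hz.1, mem_univ _⟩) z hz)).contDiffWithinAt
  refine hcomp.congr fun z hz => ?_
  rw [Function.comp_apply, Subtype.val_injective.extend_apply g 0 ⟨tangentPoint x₀ z, hz.2⟩]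
  refine Eq.trans ?_ (D.hasSymbolAt (symm_mem_chart_source hz.1) hz.2 X Y).symm
  rw [coordDeriv, show tangentCoords x₀ (vec _ _) = z from tangentCoords_tangentPoint hz.1,
    (extChartAt 𝓘(ℝ, E) x₀).right_inv hz.1]
  rfl

theorem contDiffOn_symbol (D : Connection A) (x₀ : M) :
    ContDiffOn ℝ ∞ (D.symbol x₀) (coordDomain A x₀) := by
  refine contDiffOn_clm_apply.2 fun u => contDiffOn_clm_apply.2 fun w z hz => ?_
  have hp := symm_mem_chart_source hz.1
  let frame (e : E) : VField E M := coordField x₀ ((extChartAt 𝓘(ℝ, E) x₀).symm z.1) e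
  have hrep (e : E) : rep x₀ (frame e) =ᶠ[𝓝 z.1] fun _ => e := by
    simpa only [(extChartAt 𝓘(ℝ, E) x₀).right_inv hz.1] using rep_coordField_eventuallyEq hp e
  refine ContDiffAt.contDiffWithinAt (((D.contDiffOn_coords_toFun x₀ (frame u) (frame w)).contDiffAt
    ((isOpen_coordDomain A x₀).mem_nhds hz)).congr_of_eventuallyEq ?_)
  filter_upwards [continuousAt_fst.eventually (hrep u), continuousAt_fst.eventually (hrep w),
    continuousAt_fst.eventually ((hrep w).fderiv (𝕜 := ℝ))] with y hu hw hw'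
  rw [hu, hw, hw', fderiv_fun_const]
  exact (zero_add _).symm

end Symbols

end Connection

section Chern

variable {E : Type*} [NormedAddCommGroup E] [NormedSpace ℝ E]
variable {M : Type*} [TopologicalSpace M] [ChartedSpace E M] [IsManifold 𝓘(ℝ, E) ∞ M]
variable {A : TopologicalSpace.Opens (TM E M)} {L : TM E M → ℝ} {x₀ x₁ p : M} {v : T E p}

/-- The Levi-Civita--Chern derivative `∇^v_X Y`, computed in the chart around `x₀`. -/
def chernDeriv (L : TM E M → ℝ) (x₀ : M) (v : T E p) (X Y : VField E M) : T E p :=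
  ofCoords x₀ p (coordDeriv x₀ Y (vec p (X p))
    + localChernSymbol (coordFun L x₀) (tangentCoords x₀ (vec p v))
      (coords x₀ (vec p (X p))) (coords x₀ (vec p (Y p))))

theorem hasSymbolAt_chernDeriv (hp : p ∈ (chartAt E x₀).source) (v : T E p) :
    HasSymbolAt x₀ (chernDeriv L x₀ v)
      (localChernSymbol (coordFun L x₀) (tangentCoords x₀ (vec p v))) := fun _ _ =>
  coords_ofCoords hp _

namespace Connection

theorem isMetric_iff (D : Connection A) :
    D.IsMetric L ↔ ∀ (p : M) (v : T E p) (hv : vec p v ∈ A),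
      IsMetricAt L v (fun X Y => D.toFun X Y ⟨vec p v, hv⟩) := by
  have hpointwise (X Y Z V : VField E M) (p : M) (hV : vec p (V p) ∈ A) :
      D.covDerivTensor L X Y Z V p hV = 0 ↔
        mvfderiv 𝓘(ℝ, E) (fun q => fundamentalTensor L (vec q (V q)) (Y q) (Z q)) p (X p) =
          verticalDeriv L (vec p (V p)) (D.toFun X V ⟨vec p (V p), hV⟩) (Y p) (Z p)
            + fundamentalTensor L (vec p (V p)) (D.toFun X Y ⟨vec p (V p), hV⟩) (Z p)
            + fundamentalTensor L (vec p (V p)) (Y p) (D.toFun X Z ⟨vec p (V p), hV⟩) := by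
    rw [covDerivTensor, sub_sub, sub_sub, sub_eq_zero, add_assoc]
  constructor
  · rintro h p v hv X Y Z V rfl
    exact (hpointwise X Y Z V p hv).1 (h X Y Z V p hv)
  · exact fun h X Y Z V p hV => (hpointwise X Y Z V p hV).2 (h p (V p) hV X Y Z V rfl)

end Connection

variable [FiniteDimensional ℝ E]

theorem contDiffAt_coords_chernDeriv (hL : IsPseudoFinslerMetric A L)
    (hp : p ∈ (chartAt E x₀).source) (hv : vec p v ∈ A) (X Y : VField E M) :
    ContDiffAt ℝ ∞ (fun z => fderiv ℝ (rep x₀ Y) z.1 (rep x₀ X z.1)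
      + localChernSymbol (coordFun L x₀) z (rep x₀ X z.1) (rep x₀ Y z.1))
      (tangentCoords x₀ (vec p v)) := by
  set z := tangentCoords x₀ (vec p v)
  have hrep (Z : VField E M) : ContDiffAt ℝ ∞ (rep x₀ Z ∘ Prod.fst) z :=
    (contDiffAt_rep hp Z).comp z contDiffAt_fst
  have hderiv : ContDiffAt ℝ ∞ (fderiv ℝ (rep x₀ Y) ∘ Prod.fst) z :=
    ((contDiffAt_rep hp Y).fderiv_right (m := ∞) (by simp)).comp z contDiffAt_fst
  have hΓ := (hL.isLocalMetric x₀).contDiffOn_localChernSymbol.contDiffAt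
    ((isOpen_coordDomain A x₀).mem_nhds (tangentCoords_mem_coordDomain hp hv))
  exact (hderiv.clm_apply (hrep X)).add ((hΓ.clm_apply (hrep X)).clm_apply (hrep Y))

variable [T2Space M]

theorem isTorsionFreeAt_chernDeriv (hL : IsPseudoFinslerMetric A L)
    (hp : p ∈ (chartAt E x₀).source) (hv : vec p v ∈ A) :
    IsTorsionFreeAt (chernDeriv L x₀ v) :=
  ((hasSymbolAt_chernDeriv hp v).isTorsionFreeAt_iff hp).2
    ((hL.isLocalMetric x₀).isChernData (tangentCoords_mem_coordDomain hp hv)).chernSymbol_symm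

theorem isMetricAt_chernDeriv (hL : IsPseudoFinslerMetric A L)
    (hp : p ∈ (chartAt E x₀).source) (hv : vec p v ∈ A) : IsMetricAt L v (chernDeriv L x₀ v) :=
  ((hasSymbolAt_chernDeriv hp v).isMetricAt_iff hL hp hv).2
    ((hL.isLocalMetric x₀).isChernData
      (tangentCoords_mem_coordDomain hp hv)).isCompatible_chernSymbol

theorem chernDeriv_eq_chernDeriv (hL : IsPseudoFinslerMetric A L)
    (h₀ : p ∈ (chartAt E x₀).source) (h₁ : p ∈ (chartAt E x₁).source) (hv : vec p v ∈ A) :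
    chernDeriv L x₀ v = chernDeriv L x₁ v :=
  (isTorsionFreeAt_chernDeriv hL h₀ hv).eq_of_isMetricAt (isTorsionFreeAt_chernDeriv hL h₁ hv) hL hv
    (isMetricAt_chernDeriv hL h₀ hv) (isMetricAt_chernDeriv hL h₁ hv)

theorem contMDiff_chernDeriv (hL : IsPseudoFinslerMetric A L) (X Y : VField E M) :
    ContMDiff 𝓘(ℝ, E).tangent 𝓘(ℝ, E).tangent ∞
      (fun v : A => vec v.1.proj (chernDeriv L v.1.proj v.1.snd X Y)) := by
  intro v₀
  set x₀ := v₀.1.proj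
  have hx₀ : x₀ ∈ (chartAt E x₀).source := mem_chart_source E x₀
  have hproj : ContMDiff 𝓘(ℝ, E).tangent 𝓘(ℝ, E) ∞ (fun v : A => v.1.proj) :=
    (contMDiff_proj (TangentSpace 𝓘(ℝ, E) : M → Type _)).comp contMDiff_subtype_val
  have hnear : ∀ᶠ v : A in 𝓝 v₀, v.1.proj ∈ (chartAt E x₀).source :=
    hproj.continuous.continuousAt.eventually_mem ((chartAt E x₀).open_source.mem_nhds hx₀)
  have hsource : vec x₀ (chernDeriv L x₀ v₀.1.snd X Y) ∈
      (trivializationAt E (TangentSpace 𝓘(ℝ, E)) x₀).source :=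
    (Trivialization.mem_source _).2 (mem_baseSet hx₀)
  refine (Trivialization.contMDiffAt_iff (f := fun v : A =>
    vec v.1.proj (chernDeriv L v.1.proj v.1.snd X Y)) hsource).2 ⟨hproj.contMDiffAt, ?_⟩
  have hcoords : ContMDiffAt 𝓘(ℝ, E).tangent 𝓘(ℝ, E × E) ∞
      (fun v : A => tangentCoords x₀ v.1) v₀ :=
    ((contMDiffOn_tangentCoords x₀).contMDiffAt
      (((chartAt E x₀).open_source.preimage (FiberBundle.continuous_proj E _)).mem_nhds
        hx₀)).comp v₀ contMDiff_subtype_val.contMDiffAt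
  refine ((contDiffAt_coords_chernDeriv hL hx₀ v₀.2 X Y).contMDiffAt.comp v₀
    hcoords).congr_of_eventuallyEq ?_
  filter_upwards [hnear] with v hv
  change coords x₀ (vec v.1.proj (chernDeriv L v.1.proj v.1.snd X Y)) = _
  rw [chernDeriv_eq_chernDeriv hL (mem_chart_source E v.1.proj) hv v.2,
    hasSymbolAt_chernDeriv hv v.1.snd, ← rep_extChartAt hv X, ← rep_extChartAt hv Y, coordDeriv,
    ← rep_extChartAt hv X]
  rfl

/-- The Levi-Civita--Chern connection of a pseudo-Finsler metric. At `v` it is computed in the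
preferred chart around the base point of `v`. -/
def chernConnection (hL : IsPseudoFinslerMetric A L) : Connection A where
  toFun X Y v := chernDeriv L v.1.proj v.1.snd X Y
  smooth := contMDiff_chernDeriv hL
  add_right X Y Z v :=
    let hp := mem_chart_source E v.1.proj
    (hasSymbolAt_chernDeriv hp v.1.snd).add_right hp X Y Z
  leibniz f X Y v :=
    let hp := mem_chart_source E v.1.proj
    (hasSymbolAt_chernDeriv hp v.1.snd).leibniz hp f X Y
  linear_left f h X Y Z v :=
    let hp := mem_chart_source E v.1.proj
    (hasSymbolAt_chernDeriv hp v.1.snd).linear_left hp f h X Y Z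

namespace Connection

theorem isTorsionFree_iff (D : Connection A) :
    D.IsTorsionFree ↔ ∀ v : A, IsTorsionFreeAt (fun X Y => D.toFun X Y v) := by
  have hsymbol (x₀ : M) (v : A) (hp : v.1.proj ∈ (chartAt E x₀).source) :
      IsTorsionFreeAt (fun X Y => D.toFun X Y v) ↔
        ∀ u w, D.christoffel x₀ v u w - D.christoffel x₀ v w u = 0 := by
    refine ((D.hasSymbolAt hp v.2).isTorsionFreeAt_iff hp).trans ?_
    simp only [D.symbol_tangentCoords hp v.2, sub_eq_zero]
  exact ⟨fun h v => (hsymbol _ v (mem_chart_source E _)).2 (h _ v (mem_chart_source E _)),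
    fun h x₀ v hp => (hsymbol x₀ v hp).1 (h v)⟩

theorem IsLeviCivitaChern.unique (hL : IsPseudoFinslerMetric A L) {D D' : Connection A}
    (hD : D.IsLeviCivitaChern L) (hD' : D'.IsLeviCivitaChern L) : D = D' := by
  have htoFun : D.toFun = D'.toFun := by
    funext X Y v
    exact congrFun₂ ((D.isTorsionFree_iff.1 hD.1 v).eq_of_isMetricAt
      (D'.isTorsionFree_iff.1 hD'.1 v) hL v.2 (D.isMetric_iff.1 hD.2 _ _ v.2)
      (D'.isMetric_iff.1 hD'.2 _ _ v.2)) X Y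
  cases D
  cases D'
  congr

end Connection

theorem isLeviCivitaChern_chernConnection (hL : IsPseudoFinslerMetric A L) :
    (chernConnection hL).IsLeviCivitaChern L :=
  ⟨(chernConnection hL).isTorsionFree_iff.2 fun v =>
      isTorsionFreeAt_chernDeriv hL (mem_chart_source E v.1.proj) v.2,
    (chernConnection hL).isMetric_iff.2 fun p _ hv =>
      isMetricAt_chernDeriv hL (mem_chart_source E p) hv⟩

end Chern

section Curves

variable {E : Type*} [NormedAddCommGroup E] [NormedSpace ℝ E]
variable {M : Type*} [TopologicalSpace M] [ChartedSpace E M]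
variable {γ : ℝ → M} {X : ∀ t, T E (γ t)} {s : Set ℝ} {t : ℝ} {x₀ x₁ : M}

/-- The velocity at `t` of the restriction to `s` of the curve `γ`. -/
abbrev velocityWithin (E : Type*) [NormedAddCommGroup E] [NormedSpace ℝ E]
    {M : Type*} [TopologicalSpace M] [ChartedSpace E M] (γ : ℝ → M) (s : Set ℝ) (t : ℝ) :
    T E (γ t) :=
  mfderivWithin 𝓘(ℝ, ℝ) 𝓘(ℝ, E) γ s t (1 : ℝ)

theorem eventually_mem_chart_source (hγ : ContMDiffWithinAt 𝓘(ℝ, ℝ) 𝓘(ℝ, E) ∞ γ s t)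
    (hp : γ t ∈ (chartAt E x₀).source) : ∀ᶠ τ in 𝓝[s] t, γ τ ∈ (chartAt E x₀).source :=
  hγ.continuousWithinAt.eventually_mem ((chartAt E x₀).open_source.mem_nhds hp)

variable [IsManifold 𝓘(ℝ, E) ∞ M]

theorem hasDerivWithinAt_extChartAt_comp (hp : γ t ∈ (chartAt E x₀).source)
    (hs : UniqueDiffWithinAt ℝ s t) (hγ : ContMDiffWithinAt 𝓘(ℝ, ℝ) 𝓘(ℝ, E) ∞ γ s t) :
    HasDerivWithinAt (fun τ => extChartAt 𝓘(ℝ, E) x₀ (γ τ))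
      (coords x₀ (vec (γ t) (velocityWithin E γ s t))) s t := by
  have hchart : MDifferentiableAt 𝓘(ℝ, E) 𝓘(ℝ, E) (extChartAt 𝓘(ℝ, E) x₀) (γ t) :=
    (contMDiffAt_extChartAt' (n := ∞) hp).mdifferentiableAt (by simp)
  have hγ' := hγ.mdifferentiableWithinAt (by simp)
  have hchain := mfderiv_comp_mfderivWithin t hchart hγ' hs.uniqueMDiffWithinAt
  rw [mfderivWithin_eq_fderivWithin] at hchain
  rw [coords_eq_mfderiv hp]
  exact (hchart.comp_mdifferentiableWithinAt t
    hγ').differentiableWithinAt.hasFDerivWithinAt.hasDerivWithinAt.congr_deriv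
      (DFunLike.congr_fun hchain (1 : ℝ))

theorem contMDiffWithinAt_of_vec
    (hX : ContMDiffWithinAt 𝓘(ℝ, ℝ) 𝓘(ℝ, E).tangent ∞ (fun τ => vec (γ τ) (X τ)) s t) :
    ContMDiffWithinAt 𝓘(ℝ, ℝ) 𝓘(ℝ, E) ∞ γ s t :=
  (contMDiff_proj (TangentSpace 𝓘(ℝ, E) : M → Type _)).contMDiffAt.comp_contMDiffWithinAt t hX

theorem differentiableWithinAt_coords (hp : γ t ∈ (chartAt E x₀).source)
    (hX : ContMDiffWithinAt 𝓘(ℝ, ℝ) 𝓘(ℝ, E).tangent ∞ (fun τ => vec (γ τ) (X τ)) s t) :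
    DifferentiableWithinAt ℝ (fun τ => coords x₀ (vec (γ τ) (X τ))) s t := by
  have hsource : vec (γ t) (X t) ∈ (trivializationAt E (TangentSpace 𝓘(ℝ, E)) x₀).source :=
    (Trivialization.mem_source _).2 (mem_baseSet hp)
  exact ((Trivialization.contMDiffWithinAt_iff (f := fun τ => vec (γ τ) (X τ)) hsource).1
    hX).2.contDiffWithinAt.differentiableWithinAt (by simp)

theorem hasDerivWithinAt_coords_field (hp : γ t ∈ (chartAt E x₀).source) (ht : t ∈ s)
    (hs : UniqueDiffWithinAt ℝ s t) (hγ : ContMDiffWithinAt 𝓘(ℝ, ℝ) 𝓘(ℝ, E) ∞ γ s t)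
    (Y : VField E M) :
    HasDerivWithinAt (fun τ => coords x₀ (vec (γ τ) (Y (γ τ))))
      (coordDeriv x₀ Y (vec (γ t) (velocityWithin E γ s t))) s t := by
  refine ((differentiableAt_rep hp Y).hasFDerivAt.comp_hasDerivWithinAt t
    (hasDerivWithinAt_extChartAt_comp hp hs hγ)).congr_of_eventuallyEq_of_mem ?_ ht
  filter_upwards [eventually_mem_chart_source hγ hp] with τ hτ
  exact (rep_extChartAt hτ Y).symm

theorem hasDerivWithinAt_coords_of_eq_zero (h₀ : γ t ∈ (chartAt E x₀).source)
    (h₁ : γ t ∈ (chartAt E x₁).source) (ht : t ∈ s)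
    (hγ : ContMDiffWithinAt 𝓘(ℝ, ℝ) 𝓘(ℝ, E) ∞ γ s t) (hX : X t = 0) {c : E}
    (hc : HasDerivWithinAt (fun τ => coords x₁ (vec (γ τ) (X τ))) c s t) :
    HasDerivWithinAt (fun τ => coords x₀ (vec (γ τ) (X τ)))
      (coords x₀ (vec (γ t) (ofCoords x₁ (γ t) c))) s t := by
  let e₀ := trivializationAt E (TangentSpace 𝓘(ℝ, E) : M → Type _) x₀
  let e₁ := trivializationAt E (TangentSpace 𝓘(ℝ, E) : M → Type _) x₁
  let J : M → E →L[ℝ] E := fun q => e₁.coordChangeL ℝ e₀ q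
  have hJ : ContMDiffAt 𝓘(ℝ, E) 𝓘(ℝ, E →L[ℝ] E) ∞ J (γ t) :=
    (contMDiffOn_coordChangeL (n := ∞) (IB := 𝓘(ℝ, E)) e₁ e₀).contMDiffAt
      ((e₁.open_baseSet.inter e₀.open_baseSet).mem_nhds ⟨mem_baseSet h₁, mem_baseSet h₀⟩)
  have hJγ : DifferentiableWithinAt ℝ (fun τ => J (γ τ)) s t :=
    (hJ.comp_contMDiffWithinAt t hγ).contDiffWithinAt.differentiableWithinAt (by simp)
  have hJ_apply {q : M} (hq₀ : q ∈ (chartAt E x₀).source) (hq₁ : q ∈ (chartAt E x₁).source)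
      (y : E) : J q y = coords x₀ (vec q (ofCoords x₁ q y)) :=
    e₁.coordChangeL_apply e₀ ⟨mem_baseSet hq₁, mem_baseSet hq₀⟩ y
  have hproduct := hJγ.hasDerivWithinAt.clm_apply hc
  simp only [hX, coords_zero h₁, map_zero, zero_add] at hproduct
  refine (hproduct.congr_of_eventuallyEq_of_mem ?_ ht).congr_deriv (hJ_apply h₀ h₁ c)
  filter_upwards [eventually_mem_chart_source hγ h₀, eventually_mem_chart_source hγ h₁]
    with τ hτ₀ hτ₁
  rw [hJ_apply hτ₀ hτ₁, ofCoords_coords hτ₁]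

end Curves

namespace Connection

section CovDerivAlong

variable {E : Type*} [NormedAddCommGroup E] [NormedSpace ℝ E] [FiniteDimensional ℝ E]
variable {M : Type*} [TopologicalSpace M] [T2Space M] [ChartedSpace E M] [IsManifold 𝓘(ℝ, E) ∞ M]
variable {A : TopologicalSpace.Opens (TM E M)} {γ : ℝ → M} {X : ∀ t, T E (γ t)} {a b t : ℝ}
variable {v : T E (γ t)} {x₀ : M}

theorem hasDerivWithinAt_coords_sub_field (D : Connection A)
    (hp : γ t ∈ (chartAt E x₀).source) {s : Set ℝ} (ht : t ∈ s) (hs : UniqueDiffWithinAt ℝ s t)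
    (hX : ContMDiffWithinAt 𝓘(ℝ, ℝ) 𝓘(ℝ, E).tangent ∞ (fun τ => vec (γ τ) (X τ)) s t)
    (hv : vec (γ t) v ∈ A) {Y Z : VField E M} (hY : Y (γ t) = X t)
    (hZ : Z (γ t) = velocityWithin E γ s t) :
    HasDerivWithinAt (fun τ => coords x₀ (vec (γ τ) (X τ - Y (γ τ))))
      (derivWithin (fun τ => coords x₀ (vec (γ τ) (X τ))) s t
        + D.christoffel x₀ ⟨vec (γ t) v, hv⟩
          (coords x₀ (vec (γ t) (velocityWithin E γ s t))) (coords x₀ (vec (γ t) (X t)))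
        - coords x₀ (vec (γ t) (D.toFun Z Y ⟨vec (γ t) v, hv⟩))) s t := by
  have hγ := contMDiffWithinAt_of_vec hX
  rw [D.coords_toFun hp hv, hY, hZ, add_sub_add_right_eq_sub]
  refine ((differentiableWithinAt_coords hp hX).hasDerivWithinAt.sub
    (hasDerivWithinAt_coords_field hp ht hs hγ Y)).congr_of_eventuallyEq_of_mem ?_ ht
  filter_upwards [eventually_mem_chart_source hγ hp] with τ hτ
  exact coords_sub hτ _ _

theorem coords_covDerivAlong (D : Connection A) (hab : a < b) (ht : t ∈ Icc a b)
    (hX : ContMDiffWithinAt 𝓘(ℝ, ℝ) 𝓘(ℝ, E).tangent ∞ (fun τ => vec (γ τ) (X τ)) (Icc a b) t)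
    (hv : vec (γ t) v ∈ A) (hp : γ t ∈ (chartAt E x₀).source) :
    coords x₀ (vec (γ t) (D.covDerivAlong γ a b X t v hv)) =
      derivWithin (fun τ => coords x₀ (vec (γ τ) (X τ))) (Icc a b) t
        + D.symbol x₀ (tangentCoords x₀ (vec (γ t) v))
          (coords x₀ (vec (γ t) (velocityWithin E γ (Icc a b) t)))
          (coords x₀ (vec (γ t) (X t))) := by
  have hs : UniqueDiffWithinAt ℝ (Icc a b) t := uniqueDiffOn_Icc hab t ht
  have h₁ : γ t ∈ (chartAt E (γ t)).source := mem_chart_source E _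
  let Y := coordField (γ t) (γ t) (coords (γ t) (vec (γ t) (X t)))
  let Z := coordField (γ t) (γ t) (coords (γ t) (vec (γ t) (velocityWithin E γ (Icc a b) t)))
  have hY : Y (γ t) = X t := coordField_coords h₁ _
  have hZ : Z (γ t) = velocityWithin E γ (Icc a b) t := coordField_coords h₁ _
  -- `X - Y` vanishes at `t`, so the derivatives of its coordinates in the two charts correspond.
  have hcharts := hs.eq_deriv _
    (hasDerivWithinAt_coords_of_eq_zero (X := fun τ => X τ - Y (γ τ)) hp h₁ ht
      (contMDiffWithinAt_of_vec hX) (sub_eq_zero.2 hY.symm)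
      (D.hasDerivWithinAt_coords_sub_field h₁ ht hs hX hv hY hZ))
    (D.hasDerivWithinAt_coords_sub_field hp ht hs hX hv hY hZ)
  have hdiff : ofCoords (γ t) (γ t) (coords (γ t) (vec (γ t) (D.covDerivAlong γ a b X t v hv))
        - coords (γ t) (vec (γ t) (D.toFun Z Y ⟨vec (γ t) v, hv⟩))) =
      D.covDerivAlong γ a b X t v hv - D.toFun Z Y ⟨vec (γ t) v, hv⟩ := by
    rw [← coords_sub h₁, ofCoords_coords h₁]
  rw [covDerivAlong, coords_ofCoords h₁] at hdiff
  rw [hdiff, coords_sub hp] at hcharts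
  rw [D.symbol_tangentCoords hp hv]
  exact sub_left_injective hcharts

end CovDerivAlong

end Connection

section ParallelInCoordinates

variable {E : Type*} [NormedAddCommGroup E] [NormedSpace ℝ E]

theorem hasDerivWithinAt_vertHess_of_parallel {ℓ : E × E → ℝ} {x v y w : ℝ → E} {x' : E}
    {Γ : E →L[ℝ] E →L[ℝ] E} {s : Set ℝ} {t : ℝ}
    (hg : DifferentiableAt ℝ (vertHess ℓ) (x t, v t)) (hx : HasDerivWithinAt x x' s t)
    (hv : HasDerivWithinAt v (-Γ x' (v t)) s t) (hy : HasDerivWithinAt y (-Γ x' (y t)) s t)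
    (hw : HasDerivWithinAt w (-Γ x' (w t)) s t) :
    HasDerivWithinAt (fun τ => vertHess ℓ (x τ, v τ) (y τ) (w τ))
      (horizDeriv ℓ (x t, v t) x' (y t) (w t)
        - (vertDeriv ℓ (x t, v t) (Γ x' (v t)) (y t) (w t)
          + vertHess ℓ (x t, v t) (Γ x' (y t)) (w t)
          + vertHess ℓ (x t, v t) (y t) (Γ x' (w t)))) s t := by
  obtain ⟨d, hd, hd_apply⟩ := exists_hasFDerivWithinAt_vertHess_apply hg hx.hasFDerivWithinAt
    hv.hasFDerivWithinAt hy.hasFDerivWithinAt hw.hasFDerivWithinAt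
  refine hd.hasDerivWithinAt.congr_deriv ?_
  rw [hd_apply]
  simp only [ContinuousLinearMap.toSpanSingleton_apply, one_smul, map_neg, neg_apply]
  ring

end ParallelInCoordinates

section IntegralCurves

variable {F : Type*} [NormedAddCommGroup F] [NormedSpace ℝ F] [CompleteSpace F]

theorem exists_contDiffOn_hasDerivAt_of_mem {f : F → F} {Ω : Set F} {y₀ : F} (hΩ : IsOpen Ω)
    (hf : ContDiffOn ℝ ∞ f Ω) (hy₀ : y₀ ∈ Ω) :
    ∃ ε > 0, ∃ α : ℝ → F, α 0 = y₀ ∧ ContDiffOn ℝ ∞ α (Icc 0 ε) ∧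
      ∀ t ∈ Icc 0 ε, α t ∈ Ω ∧ HasDerivAt α (f (α t)) t := by
  obtain ⟨α, hα₀, η, hη, hα⟩ := ((hf.contDiffAt (hΩ.mem_nhds hy₀)).of_le
    (by simp)).exists_forall_mem_closedBall_exists_eq_forall_mem_Ioo_hasDerivAt₀ (0 : ℝ)
  have hnear : ∀ᶠ t in 𝓝 (0 : ℝ), α t ∈ Ω ∧ HasDerivAt α (f (α t)) t := by
    have hzero : (0 : ℝ) ∈ Ioo (0 - η) (0 + η) := ⟨by linarith, by linarith⟩
    exact ((hα 0 hzero).continuousAt.eventually_mem (hΩ.mem_nhds (by rwa [hα₀]))).and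
      (Filter.mem_of_superset (Ioo_mem_nhds hzero.1 hzero.2) hα)
  obtain ⟨ε, hε, hball⟩ := Metric.nhds_basis_closedBall.eventually_iff.1 hnear
  have hsolves : ∀ t ∈ Icc 0 ε, α t ∈ Ω ∧ HasDerivAt α (f (α t)) t := fun t ht =>
    hball (by rw [Metric.mem_closedBall, Real.dist_0_eq_abs, abs_of_nonneg ht.1]; exact ht.2)
  refine ⟨ε, hε, α, hα₀, ?_, hsolves⟩
  exact ODE.contDiffOn_enat_Icc_of_hasDerivWithinAt (n := ⊤) (f := fun _ => f) (u := Ω)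
    (hf.comp contDiffOn_snd fun _ hq => hq.2)
    (fun t ht => (hsolves t ht).2.hasDerivWithinAt) (fun t ht => (hsolves t ht).1)

end IntegralCurves

section ChartCurves

variable {E : Type*} [NormedAddCommGroup E] [NormedSpace ℝ E]
variable {M : Type*} [TopologicalSpace M] [ChartedSpace E M]

/-- The curve in `M` with coordinates `x` in the chart around `x₀`. -/
def chartCurve (x₀ : M) (x : ℝ → E) (t : ℝ) : M :=
  (extChartAt 𝓘(ℝ, E) x₀).symm (x t)

theorem chartCurve_mem_chart_source {x₀ : M} {x : ℝ → E} {t : ℝ}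
    (ht : x t ∈ (extChartAt 𝓘(ℝ, E) x₀).target) :
    chartCurve x₀ x t ∈ (chartAt E x₀).source :=
  symm_mem_chart_source ht

variable [IsManifold 𝓘(ℝ, E) ∞ M]

/-- The vector field along `chartCurve x₀ x` with coordinates `y` in the chart around `x₀`. -/
def chartField (x₀ : M) (x y : ℝ → E) (t : ℝ) : T E (chartCurve x₀ x t) :=
  ofCoords x₀ _ (y t)

variable {x₀ : M} {x y : ℝ → E} {s : Set ℝ} {t : ℝ}

theorem contMDiffOn_chartCurve (hx : ContDiffOn ℝ ∞ x s)
    (hs : MapsTo x s (extChartAt 𝓘(ℝ, E) x₀).target) :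
    ContMDiffOn 𝓘(ℝ, ℝ) 𝓘(ℝ, E) ∞ (chartCurve x₀ x) s :=
  (contMDiffOn_extChartAt_symm x₀).comp hx.contMDiffOn hs

theorem contMDiffOn_chartField (hx : ContDiffOn ℝ ∞ x s) (hy : ContDiffOn ℝ ∞ y s)
    (hs : MapsTo x s (extChartAt 𝓘(ℝ, E) x₀).target) :
    ContMDiffOn 𝓘(ℝ, ℝ) 𝓘(ℝ, E).tangent ∞
      (fun t => vec (chartCurve x₀ x t) (chartField x₀ x y t)) s :=
  (contMDiffOn_tangentPoint x₀).comp (hx.prodMk hy).contMDiffOn fun _ ht => ⟨hs ht, mem_univ _⟩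

theorem chartField_mem {A : TopologicalSpace.Opens (TM E M)}
    (ht : (x t, y t) ∈ coordDomain A x₀) : vec (chartCurve x₀ x t) (chartField x₀ x y t) ∈ A :=
  ht.2

theorem tangentCoords_chartField (ht : x t ∈ (extChartAt 𝓘(ℝ, E) x₀).target) :
    tangentCoords x₀ (vec (chartCurve x₀ x t) (chartField x₀ x y t)) = (x t, y t) :=
  tangentCoords_tangentPoint (z := (x t, y t)) ht

theorem coords_chartField (ht : x t ∈ (extChartAt 𝓘(ℝ, E) x₀).target) :
    coords x₀ (vec (chartCurve x₀ x t) (chartField x₀ x y t)) = y t :=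
  coords_ofCoords (chartCurve_mem_chart_source ht) _

theorem fundamentalTensor_chartField {A : TopologicalSpace.Opens (TM E M)} {L : TM E M → ℝ}
    (hL : ContMDiffOn 𝓘(ℝ, E).tangent 𝓘(ℝ, ℝ) ∞ L A) {v w : ℝ → E}
    (ht : (x t, v t) ∈ coordDomain A x₀) :
    fundamentalTensor L (vec (chartCurve x₀ x t) (chartField x₀ x v t)) (chartField x₀ x y t)
      (chartField x₀ x w t) = vertHess (coordFun L x₀) (x t, v t) (y t) (w t) := by
  rw [fundamentalTensor_eq hL (chartCurve_mem_chart_source ht.1) (chartField_mem ht),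
    tangentCoords_chartField ht.1, coords_chartField ht.1, coords_chartField ht.1]

theorem coords_velocityWithin_chartCurve {x' : E} (hx : ContDiffOn ℝ ∞ x s)
    (hs : MapsTo x s (extChartAt 𝓘(ℝ, E) x₀).target) (ht : t ∈ s)
    (huniq : UniqueDiffWithinAt ℝ s t) (hx' : HasDerivWithinAt x x' s t) :
    coords x₀ (vec (chartCurve x₀ x t) (velocityWithin E (chartCurve x₀ x) s t)) = x' := by
  have hcoords : EqOn (fun τ => extChartAt 𝓘(ℝ, E) x₀ (chartCurve x₀ x τ)) x s := fun τ hτ =>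
    (extChartAt 𝓘(ℝ, E) x₀).right_inv (hs hτ)
  exact huniq.eq_deriv _ (hasDerivWithinAt_extChartAt_comp (chartCurve_mem_chart_source (hs ht))
    huniq (contMDiffOn_chartCurve hx hs t ht)) (hx'.congr hcoords (hcoords ht))

end ChartCurves

namespace Connection

section Transport

variable {E : Type*} [NormedAddCommGroup E] [NormedSpace ℝ E] [FiniteDimensional ℝ E]
variable {M : Type*} [TopologicalSpace M] [T2Space M] [ChartedSpace E M] [IsManifold 𝓘(ℝ, E) ∞ M]
variable {A : TopologicalSpace.Opens (TM E M)} {L : TM E M → ℝ} {a b t : ℝ} {x₀ : M}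

theorem hasDerivWithinAt_coords_of_covDerivAlong_eq_zero (D : Connection A) {γ : ℝ → M}
    {X : ∀ t, T E (γ t)} {v : T E (γ t)} (hab : a < b) (ht : t ∈ Icc a b)
    (hX : ContMDiffWithinAt 𝓘(ℝ, ℝ) 𝓘(ℝ, E).tangent ∞ (fun τ => vec (γ τ) (X τ)) (Icc a b) t)
    (hv : vec (γ t) v ∈ A) (hp : γ t ∈ (chartAt E x₀).source)
    (hzero : D.covDerivAlong γ a b X t v hv = 0) :
    HasDerivWithinAt (fun τ => coords x₀ (vec (γ τ) (X τ)))
      (-D.symbol x₀ (tangentCoords x₀ (vec (γ t) v))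
        (coords x₀ (vec (γ t) (velocityWithin E γ (Icc a b) t)))
        (coords x₀ (vec (γ t) (X t)))) (Icc a b) t := by
  have hcoords := D.coords_covDerivAlong hab ht hX hv hp
  rw [hzero, coords_zero hp] at hcoords
  exact (differentiableWithinAt_coords hp hX).hasDerivWithinAt.congr_deriv
    (eq_neg_of_add_eq_zero_left hcoords.symm)

theorem covDerivAlong_chartField_eq_zero (D : Connection A) {x v y : ℝ → E} {x' : E}
    (hab : a < b) (ht : t ∈ Icc a b) (hx : ContDiffOn ℝ ∞ x (Icc a b))
    (hy : ContDiffOn ℝ ∞ y (Icc a b))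
    (hdom : ∀ τ ∈ Icc a b, (x τ, v τ) ∈ coordDomain A x₀)
    (hx' : HasDerivWithinAt x x' (Icc a b) t)
    (hy' : HasDerivWithinAt y (-D.symbol x₀ (x t, v t) x' (y t)) (Icc a b) t) :
    D.covDerivAlong (chartCurve x₀ x) a b (chartField x₀ x y) t (chartField x₀ x v t)
      (chartField_mem (hdom t ht)) = 0 := by
  have hs : MapsTo x (Icc a b) (extChartAt 𝓘(ℝ, E) x₀).target := fun τ hτ => (hdom τ hτ).1
  have huniq := uniqueDiffOn_Icc hab t ht
  have hp := chartCurve_mem_chart_source (hs ht)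
  refine coords_injective hp ?_
  rw [D.coords_covDerivAlong hab ht (contMDiffOn_chartField hx hy hs t ht) _ hp, coords_zero hp,
    tangentCoords_chartField (hs ht), coords_velocityWithin_chartCurve hx hs ht huniq hx',
    coords_chartField (hs ht), derivWithin_congr (fun τ hτ => coords_chartField (hs hτ))
      (coords_chartField (hs ht)), hy'.derivWithin huniq, neg_add_cancel]

theorem IsMetric.preservesFundamentalTensor {D : Connection A} (hD : D.IsMetric L)
    (hL : IsPseudoFinslerMetric A L) : D.PreservesFundamentalTensor L := by
  intro a b γ hab hγ V U W hV hU hW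
  have hconst : ∀ t ∈ Icc a b, HasDerivWithinAt
      (fun τ => fundamentalTensor L (vec (γ τ) (V τ)) (U τ) (W τ)) 0 (Icc a b) t := by
    intro t ht
    have hp : γ t ∈ (chartAt E (γ t)).source := mem_chart_source E _
    have hv := hV.admissible t ht
    have hcompat := ((D.hasSymbolAt hp hv).isMetricAt_iff hL hp hv).1
      (D.isMetric_iff.1 hD _ _ hv)
    have hderiv := hasDerivWithinAt_vertHess_of_parallel
      ((hL.isLocalMetric (γ t)).differentiableAt_vertHess (tangentCoords_mem_coordDomain hp hv))
      (hasDerivWithinAt_extChartAt_comp hp (uniqueDiffOn_Icc hab t ht) (hγ t ht))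
      (D.hasDerivWithinAt_coords_of_covDerivAlong_eq_zero hab ht (hV.smooth t ht) hv hp
        (hV.parallel t ht))
      (D.hasDerivWithinAt_coords_of_covDerivAlong_eq_zero hab ht (hU.smooth t ht) hv hp
        (hU.parallel t ht))
      (D.hasDerivWithinAt_coords_of_covDerivAlong_eq_zero hab ht (hW.smooth t ht) hv hp
        (hW.parallel t ht))
    refine (hderiv.congr_of_eventuallyEq_of_mem ?_ ht).congr_deriv
      (sub_eq_zero.2 (hcompat _ _ _))
    filter_upwards [eventually_mem_chart_source (hγ t ht) hp, self_mem_nhdsWithin] with τ hτ hτs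
    exact fundamentalTensor_eq hL.smooth hτ (hV.admissible τ hτs) _ _
  exact constant_of_derivWithin_zero (fun t ht => (hconst t ht).differentiableWithinAt)
    (fun t ht => (hconst t (Ico_subset_Icc_self ht)).derivWithin
      (uniqueDiffOn_Icc hab t (Ico_subset_Icc_self ht))) b (right_mem_Icc.2 hab.le)

/-- The vector field whose integral curves describe, in coordinates, parallel transport along the
coordinate line in the direction `u`: the components are the curve, the parallel observer and two
parallel vector fields. -/
def transportField (D : Connection A) (x₀ : M) (u : E) (q : (E × E) × (E × E)) :
    (E × E) × (E × E) :=
  ((u, -D.symbol x₀ q.1 u q.1.2), (-D.symbol x₀ q.1 u q.2.1, -D.symbol x₀ q.1 u q.2.2))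

theorem contDiffOn_transportField (D : Connection A) (x₀ : M) (u : E) :
    ContDiffOn ℝ ∞ (D.transportField x₀ u) (Prod.fst ⁻¹' coordDomain A x₀) := by
  have hsymbol : ContDiffOn ℝ ∞ (fun q : (E × E) × (E × E) => D.symbol x₀ q.1 u)
      (Prod.fst ⁻¹' coordDomain A x₀) :=
    ((D.contDiffOn_symbol x₀).comp contDiffOn_fst fun _ hq => hq).clm_apply contDiffOn_const
  have hcomponent (e : (E × E) × (E × E) → E) (he : ContDiff ℝ ∞ e) :
      ContDiffOn ℝ ∞ (fun q => -D.symbol x₀ q.1 u (e q)) (Prod.fst ⁻¹' coordDomain A x₀) :=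
    (hsymbol.clm_apply he.contDiffOn).neg
  exact (contDiffOn_const.prodMk (hcomponent _ (by fun_prop))).prodMk
    ((hcomponent _ (by fun_prop)).prodMk (hcomponent _ (by fun_prop)))

theorem PreservesFundamentalTensor.vertHess_eq {D : Connection A}
    (hD : D.PreservesFundamentalTensor L) (hL : IsPseudoFinslerMetric A L) {u : E}
    {α : ℝ → (E × E) × (E × E)} (hab : a < b) (hsmooth : ContDiffOn ℝ ∞ α (Icc a b))
    (hα : ∀ t ∈ Icc a b,
      (α t).1 ∈ coordDomain A x₀ ∧ HasDerivAt α (D.transportField x₀ u (α t)) t) :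
    vertHess (coordFun L x₀) (α b).1 (α b).2.1 (α b).2.2 =
      vertHess (coordFun L x₀) (α a).1 (α a).2.1 (α a).2.2 := by
  let x := fun t => (α t).1.1
  let v := fun t => (α t).1.2
  have hx : ContDiffOn ℝ ∞ x (Icc a b) := hsmooth.fst.fst
  have hs : MapsTo x (Icc a b) (extChartAt 𝓘(ℝ, E) x₀).target := fun t ht => (hα t ht).1.1
  have hv : ∀ t ∈ Icc a b, vec (chartCurve x₀ x t) (chartField x₀ x v t) ∈ A := fun t ht =>
    chartField_mem (hα t ht).1
  have hsmooth_field {y : ℝ → E} (hy : ContDiffOn ℝ ∞ y (Icc a b)) :=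
    contMDiffOn_chartField hx hy hs
  have hparallel {y : ℝ → E} (hy : ContDiffOn ℝ ∞ y (Icc a b))
      (hy' : ∀ t ∈ Icc a b, HasDerivAt y (-D.symbol x₀ (α t).1 u (y t)) t) :
      ∀ t (ht : t ∈ Icc a b), D.covDerivAlong (chartCurve x₀ x) a b (chartField x₀ x y) t
        (chartField x₀ x v t) (hv t ht) = 0 := fun t ht =>
    D.covDerivAlong_chartField_eq_zero hab ht hx hy (fun τ hτ => (hα τ hτ).1)
      (hα t ht).2.hasDerivWithinAt.fst.fst (hy' t ht).hasDerivWithinAt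
  have hpreserves := hD a b (chartCurve x₀ x) hab (contMDiffOn_chartCurve hx hs)
    (chartField x₀ x v) (chartField x₀ x fun t => (α t).2.1) (chartField x₀ x fun t => (α t).2.2)
    ⟨hsmooth_field hsmooth.fst.snd, hv,
      hparallel hsmooth.fst.snd fun t ht => (hα t ht).2.fst.snd⟩
    ⟨hsmooth_field hsmooth.snd.fst, hparallel hsmooth.snd.fst fun t ht => (hα t ht).2.snd.fst⟩
    ⟨hsmooth_field hsmooth.snd.snd, hparallel hsmooth.snd.snd fun t ht => (hα t ht).2.snd.snd⟩
  rwa [fundamentalTensor_chartField hL.smooth (hα b (right_mem_Icc.2 hab.le)).1,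
    fundamentalTensor_chartField hL.smooth (hα a (left_mem_Icc.2 hab.le)).1] at hpreserves

theorem PreservesFundamentalTensor.isCompatibleAt {D : Connection A}
    (hD : D.PreservesFundamentalTensor L) (hL : IsPseudoFinslerMetric A L) {z : E × E}
    (hz : z ∈ coordDomain A x₀) : IsCompatibleAt (coordFun L x₀) z (D.symbol x₀ z) := by
  intro u y w
  have : CompleteSpace E := FiniteDimensional.complete ℝ E
  obtain ⟨ε, hε, α, hα₀, hsmooth, hα⟩ := exists_contDiffOn_hasDerivAt_of_mem
    ((isOpen_coordDomain A x₀).preimage continuous_fst) (D.contDiffOn_transportField x₀ u)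
    (y₀ := (z, (y, w))) hz
  have hzero : (0 : ℝ) ∈ Icc 0 ε := left_mem_Icc.2 hε.le
  have hconst : EqOn (fun t => vertHess (coordFun L x₀) (α t).1 (α t).2.1 (α t).2.2)
      (fun _ => vertHess (coordFun L x₀) (α 0).1 (α 0).2.1 (α 0).2.2) (Icc 0 ε) := by
    intro t ht
    rcases ht.1.eq_or_lt with rfl | hpos
    · rfl
    · have hsub : Icc 0 t ⊆ Icc 0 ε := Icc_subset_Icc_right ht.2
      exact hD.vertHess_eq hL hpos (hsmooth.mono hsub) fun τ hτ => hα τ (hsub hτ)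
  have hdiff : DifferentiableAt ℝ (vertHess (coordFun L x₀)) ((α 0).1.1, (α 0).1.2) :=
    (hL.isLocalMetric x₀).differentiableAt_vertHess (hα 0 hzero).1
  have hderiv := (hα 0 hzero).2.hasDerivWithinAt (s := Icc 0 ε)
  have hparallel := (uniqueDiffOn_Icc hε 0 hzero).eq_deriv _
    (hasDerivWithinAt_vertHess_of_parallel hdiff hderiv.fst.fst hderiv.fst.snd hderiv.snd.fst
      hderiv.snd.snd)
    ((hasDerivWithinAt_const 0 _ _).congr_of_mem hconst hzero)
  simp only [hα₀] at hparallel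
  exact sub_eq_zero.1 hparallel

theorem PreservesFundamentalTensor.isMetric {D : Connection A}
    (hD : D.PreservesFundamentalTensor L) (hL : IsPseudoFinslerMetric A L) : D.IsMetric L := by
  refine D.isMetric_iff.2 fun p v hv => ?_
  have hp : p ∈ (chartAt E p).source := mem_chart_source E p
  exact ((D.hasSymbolAt hp hv).isMetricAt_iff hL hp hv).2
    (hD.isCompatibleAt hL (tangentCoords_mem_coordDomain hp hv))

end Transport

end Connection

end Aniso

end

open Aniso in
theorem mainTheorem5 {E : Type*} [NormedAddCommGroup E] [NormedSpace ℝ E] [FiniteDimensional ℝ E]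
    {M : Type*} [TopologicalSpace M] [T2Space M] [ChartedSpace E M] [IsManifold 𝓘(ℝ, E) ∞ M]
    (A : TopologicalSpace.Opens (TM E M)) (L : TM E M → ℝ) (hL : IsPseudoFinslerMetric A L) :
    ∃ D : Connection A,
      (D.IsLeviCivitaChern L ∧ ∀ D' : Connection A, D'.IsLeviCivitaChern L → D' = D) ∧
      (D.IsTorsionFree ∧ D.PreservesFundamentalTensor L) ∧
      ∀ D' : Connection A, D'.IsTorsionFree → D'.PreservesFundamentalTensor L → D' = D := by
  have hC := isLeviCivitaChern_chernConnection hL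
  exact ⟨chernConnection hL, ⟨hC, fun D' hD' => hD'.unique hL hC⟩,
    ⟨hC.1, hC.2.preservesFundamentalTensor hL⟩,
    fun D' ht hp => Connection.IsLeviCivitaChern.unique hL ⟨ht, hp.isMetric hL⟩ hC⟩
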